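/- Let $0<r<1$, $\alpha\ge 0$, and $q_L,q_R\in\mathbb{C}$ with $|q_L|^2+|q_R|^2=1$. Let $r(n)\in[0,1]$ be given by $\sqrt{r(n)}=r/n^{\alpha}$ $(n\ge 1)$, and let $$H_n=\begin{bmatrix}\sqrt{r(n)}&\sqrt{1-r(n)}\\ \sqrt{1-r(n)}&-\sqrt{r(n)}\end{bmatrix},\qquad P_n=e_Le_L^\dagger H_n,\quad Q_n=e_Re_R^\dagger H_n,$$ where $e_L=(1,0)^T$, $e_R=(0,1)^T$. For each final time $n$ let $\Psi^{(n)}_0(x)=\delta_0(x)(q_Le_L+q_Re_R)$ and $\Psi^{(n)}_m(x)=Q_n\Psi^{(n)}_{m-1}(x-1)+P_n\Psi^{(n)}_{m-1}(x+1)$ for $m\ge 1$, $x\in\mathbb{Z}$. Let $X_n$ be the final-time-dependent quantum walk at its final time, i.e. the $\mathbb{Z}$-valued random variable with $P(X_n=x)=\|\Psi^{(n)}_n(x)\|^2$. Then, as $n\to\infty$: 1. If $\alpha=0$ and the initial coin state is symmetric, i.e. $|q_L|=|q_R|=1/\sqrt2$ and $a q_L\overline{b q_R}+\overline{a q_L}\,b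 q_R=0$ with $a=r$, $b=\sqrt{1-r^2}$, then $X_n/n^{1-\alpha}=X_n/n$ converges weakly to Konno's law $K(r)$, which has density $\dfrac{\sqrt{1-r^2}}{\pi(1-x^2)\sqrt{r^2-x^2}}\mathbf 1_{(-r,r)}(x)$. 2. If $0<\alpha<1$, then $X_n/n^{1-\alpha}$ converges weakly to the law $A^{\varphi_0}(r)$ with density $\Bigl\{1-(q_L\overline{q_R}+\overline{q_L}q_R)\dfrac{x}{r}\Bigr\}\dfrac{\mathbf 1_{(-r,r)}(x)}{\pi\sqrt{r^2-x^2}}$. 3. If $\alpha=1$, then for every $x\in\mathbb{Z}$ $$P(X_n=x)\sim\frac{1+(-1)^{n+x}}{2}\,\mathcal J(x;r),$$ $$\mathcal J(x;t)=\Bigl\{1-(\overline{q_R}q_L+q_R\overline{q_L})\frac{2x}{t}\Bigr\}J_x^2(t)+|q_L|^2J_{x-1}^2(t)+|q_R|^2J_{x+1}^2(t),$$ where $J_m$ is the Bessel function of the first kind of order $m$, and $f(n)\sim g(n)$ means $f(n)-g(n)=o(g(n))$ (so the left side is $0$ for all large $n$ with $n+x$ odd). 4. If $\alpha>1$, then for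 every $x\in\mathbb{Z}$: along even $n$, $P(X_n=x)\to\delta_0(x)$; along odd $n$, $P(X_n=x)\to|q_L|^2\delta_1(x)+|q_R|^2\delta_{-1}(x)$. (Here $\delta_y(x)=1$ if $x=y$ and $0$ otherwise.) -/

import Mathlib

open MeasureTheory ProbabilityTheory Filter Topology Asymptotics
open scoped Matrix ComplexConjugate

noncomputable section

namespace QW

/-! Coin space `ℂ²` with basis `e_L` (index `0`) and `e_R` (index `1`). -/

def eL : Fin 2 → ℂ := ![1, 0]

def eR : Fin 2 → ℂ := ![0, 1]

/-- The part `P = e_L e_L† H` of the coin, which moves the walker one step to the left. -/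
def matP (H : Matrix (Fin 2) (Fin 2) ℂ) : Matrix (Fin 2) (Fin 2) ℂ :=
  Matrix.vecMulVec eL (star eL) * H

/-- The part `Q = e_R e_R† H` of the coin, which moves the walker one step to the right. -/
def matQ (H : Matrix (Fin 2) (Fin 2) ℂ) : Matrix (Fin 2) (Fin 2) ℂ :=
  Matrix.vecMulVec eR (star eR) * H

/-- The coin state `Ψ_m(x)` of the discrete-time quantum walk with coin `H` and initial coin
state `φ` at the origin. -/
def amplitude (H : Matrix (Fin 2) (Fin 2) ℂ) (φ : Fin 2 → ℂ) : ℕ → ℤ → Fin 2 → ℂ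
  | 0, x => if x = 0 then φ else 0
  | m + 1, x => matQ H *ᵥ amplitude H φ m (x - 1) + matP H *ᵥ amplitude H φ m (x + 1)

/-- The probability `‖Ψ_m(x)‖²` (squared Euclidean norm) of finding the walk at `x` at time `m`. -/
def prob (H : Matrix (Fin 2) (Fin 2) ℂ) (φ : Fin 2 → ℂ) (m : ℕ) (x : ℤ) : ℝ :=
  ∑ j, ‖amplitude H φ m x j‖ ^ 2

theorem matP_mulVec (H : Matrix (Fin 2) (Fin 2) ℂ) (v : Fin 2 → ℂ) :
    matP H *ᵥ v = ![(H *ᵥ v) 0, 0] := by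
  rw [matP, ← Matrix.mulVec_mulVec]
  generalize H *ᵥ v = w
  ext i
  fin_cases i <;> simp [Matrix.mulVec, dotProduct, Fin.sum_univ_two, Matrix.vecMulVec_apply, eL,
    -Matrix.vecMulVec_cons, -Matrix.cons_vecMulVec]

theorem matQ_mulVec (H : Matrix (Fin 2) (Fin 2) ℂ) (v : Fin 2 → ℂ) :
    matQ H *ᵥ v = ![0, (H *ᵥ v) 1] := by
  rw [matQ, ← Matrix.mulVec_mulVec]
  generalize H *ᵥ v = w
  ext i
  fin_cases i <;> simp [Matrix.mulVec, dotProduct, Fin.sum_univ_two, Matrix.vecMulVec_apply, eR,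
    -Matrix.vecMulVec_cons, -Matrix.cons_vecMulVec]

theorem sum_normSq_unitary_mulVec (H : Matrix.unitaryGroup (Fin 2) ℂ) (v : Fin 2 → ℂ) :
    ∑ j, ‖((H : Matrix (Fin 2) (Fin 2) ℂ) *ᵥ v) j‖ ^ 2 = ∑ j, ‖v j‖ ^ 2 := by
  have key : ∀ w : Fin 2 → ℂ, ((∑ j, ‖w j‖ ^ 2 : ℝ) : ℂ) = star w ⬝ᵥ w := by
    intro w
    simp [dotProduct, Complex.conj_mul']
  have hH : (H : Matrix (Fin 2) (Fin 2) ℂ)ᴴ * H = 1 := Matrix.mem_unitaryGroup_iff'.1 H.2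
  have h2 : star ((H : Matrix (Fin 2) (Fin 2) ℂ) *ᵥ v) ⬝ᵥ ((H : Matrix (Fin 2) (Fin 2) ℂ) *ᵥ v)
      = star v ⬝ᵥ v := by
    rw [Matrix.star_mulVec, Matrix.dotProduct_mulVec, Matrix.vecMul_vecMul, hH, Matrix.vecMul_one]
  exact_mod_cast (key _).trans (h2.trans (key _).symm)

theorem hasSum_prob (H : Matrix.unitaryGroup (Fin 2) ℂ) (φ : Fin 2 → ℂ)
    (hφ : ‖φ 0‖ ^ 2 + ‖φ 1‖ ^ 2 = 1) (m : ℕ) : HasSum (prob H φ m) 1 := by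
  induction m with
  | zero =>
    have h := hasSum_ite_eq (0 : ℤ) (1 : ℝ)
    convert h using 1
    funext x
    by_cases hx : x = 0 <;> simp [prob, amplitude, hx, Fin.sum_univ_two, hφ]
  | succ m ih =>
    set f : ℤ → Fin 2 → ℂ := fun x => (H : Matrix (Fin 2) (Fin 2) ℂ) *ᵥ amplitude H φ m x with hf
    have hsum : ∀ x, ‖f x 0‖ ^ 2 + ‖f x 1‖ ^ 2 = prob H φ m x := by
      intro x
      have := sum_normSq_unitary_mulVec H (amplitude H φ m x)
      rwa [Fin.sum_univ_two] at this
    have hs0 : Summable fun x => ‖f x 0‖ ^ 2 :=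
      Summable.of_nonneg_of_le (fun _ => sq_nonneg _)
        (fun x => by rw [← hsum x]; linarith [sq_nonneg ‖f x 1‖]) ih.summable
    have hs1 : Summable fun x => ‖f x 1‖ ^ 2 :=
      Summable.of_nonneg_of_le (fun _ => sq_nonneg _)
        (fun x => by rw [← hsum x]; linarith [sq_nonneg ‖f x 0‖]) ih.summable
    have htot : (∑' x, ‖f x 0‖ ^ 2) + ∑' x, ‖f x 1‖ ^ 2 = 1 := by
      rw [← hs0.tsum_add hs1, ← ih.tsum_eq]
      exact tsum_congr hsum
    have e0 := (Equiv.addRight (1 : ℤ)).hasSum_iff.2 hs0.hasSum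
    have e1 := (Equiv.subRight (1 : ℤ)).hasSum_iff.2 hs1.hasSum
    rw [← htot]
    convert e0.add e1 using 1
    funext x
    have hL : amplitude H φ (m + 1) x 0 = f (x + 1) 0 := by
      rw [amplitude, matP_mulVec, matQ_mulVec]
      simp [hf]
    have hR : amplitude H φ (m + 1) x 1 = f (x - 1) 1 := by
      rw [amplitude, matP_mulVec, matQ_mulVec]
      simp [hf]
    simp [prob, Fin.sum_univ_two, hL, hR]

/-- The law of the walk at time `m`: a probability distribution on `ℤ`. -/
def law (H : Matrix.unitaryGroup (Fin 2) ℂ) (φ : Fin 2 → ℂ)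
    (hφ : ‖φ 0‖ ^ 2 + ‖φ 1‖ ^ 2 = 1) (m : ℕ) : PMF ℤ :=
  ⟨fun x => ENNReal.ofReal (prob H φ m x), by
    have h := hasSum_prob H φ hφ m
    have h0 : ∀ x, 0 ≤ prob H φ m x := fun x => Finset.sum_nonneg fun _ _ => sq_nonneg _
    rw [← ENNReal.ofReal_one, ← h.tsum_eq, ENNReal.ofReal_tsum_of_nonneg h0 h.summable]
    exact ENNReal.summable.hasSum⟩

/-- The final-time-dependent coin with parameter `ρ = r(n)`. -/
def ftdCoin (ρ : unitInterval) : Matrix.unitaryGroup (Fin 2) ℂ :=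
  ⟨!![((√(ρ : ℝ) : ℝ) : ℂ), ((√(1 - (ρ : ℝ)) : ℝ) : ℂ);
      ((√(1 - (ρ : ℝ)) : ℝ) : ℂ), -((√(ρ : ℝ) : ℝ) : ℂ)], by
    have h0 : (0 : ℝ) ≤ ρ := ρ.2.1
    have h1 : (0 : ℝ) ≤ 1 - ρ := sub_nonneg.2 ρ.2.2
    have hs : ((√(ρ : ℝ) : ℝ) : ℂ) * ((√(ρ : ℝ) : ℝ) : ℂ) = ((ρ : ℝ) : ℂ) := by
      exact_mod_cast Real.mul_self_sqrt h0
    have ht : ((√(1 - (ρ : ℝ)) : ℝ) : ℂ) * ((√(1 - (ρ : ℝ)) : ℝ) : ℂ) = 1 - ((ρ : ℝ) : ℂ) := by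
      exact_mod_cast Real.mul_self_sqrt h1
    rw [Matrix.mem_unitaryGroup_iff]
    ext i j
    fin_cases i <;> fin_cases j <;>
      simp [Matrix.mul_apply, Fin.sum_univ_two, Matrix.star_apply, hs, ht] <;> ring⟩

/-- The law of `X_n`, the final-time-dependent walk at its final time `n`. All `n` steps use
the coin with parameter `ρ n`; the initial coin state is `q_L e_L + q_R e_R`. -/
def ftdLaw (ρ : ℕ → unitInterval) (qL qR : ℂ) (hq : ‖qL‖ ^ 2 + ‖qR‖ ^ 2 = 1) (n : ℕ) : PMF ℤ :=
  law (ftdCoin (ρ n)) (qL • eL + qR • eR) (by simpa [eL, eR] using hq) n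

/-- Symmetric initial coin state for a coin with first row `(a, b)`. -/
def IsSymmetricState (a b qL qR : ℂ) : Prop :=
  ‖qR‖ = 1 / √2 ∧ ‖qL‖ = 1 / √2 ∧ a * qL * conj (b * qR) + conj (a * qL) * (b * qR) = 0

/-- The density of `K(a)`. -/
def konnoDensity (a x : ℝ) : ℝ :=
  (Set.Ioo (-|a|) |a|).indicator
    (fun x => √(1 - |a| ^ 2) / (Real.pi * (1 - x ^ 2) * √(|a| ^ 2 - x ^ 2))) x

/-- The density of `A^φ(r)` for `φ = q_L e_L + q_R e_R`; the factor `q_L q̄_R + q̄_L q_R` is real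
and equals `2 Re (q_L q̄_R)`. -/
def arcsineDensity (qL qR : ℂ) (r x : ℝ) : ℝ :=
  (1 - (qL * conj qR + conj qL * qR).re * x / r) *
    (Set.Ioo (-|r|) |r|).indicator (fun x => 1 / (Real.pi * √(r ^ 2 - x ^ 2))) x

theorem isProbabilityMeasure_of_primitive {c : ℝ} (hc : 0 < c) {f F : ℝ → ℝ}
    (hcont : ContinuousOn F (Set.Icc (-c) c))
    (hderiv : ∀ x ∈ Set.Ioo (-c) c, HasDerivAt F (f x) x)
    (hpos : ∀ x ∈ Set.Ioo (-c) c, 0 ≤ f x) (hF : F c - F (-c) = 1) {g : ℝ → ℝ}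
    (hg : ∀ x, g x = (Set.Ioo (-c) c).indicator f x) :
    IsProbabilityMeasure (volume.withDensity fun x => ENNReal.ofReal (g x)) := by
  have hle : -c ≤ c := by linarith
  have hint : IntegrableOn f (Set.Ioc (-c) c) :=
    intervalIntegral.integrableOn_deriv_of_nonneg hcont hderiv hpos
  have hval : ∫ x in (-c)..c, f x = 1 := by
    rw [← hF]
    exact intervalIntegral.integral_eq_sub_of_hasDerivAt_of_le hle hcont hderiv
      ((intervalIntegrable_iff_integrableOn_Ioc_of_le hle).2 hint)
  rw [intervalIntegral.integral_of_le hle, integral_Ioc_eq_integral_Ioo] at hval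
  refine ⟨?_⟩
  rw [withDensity_apply _ MeasurableSet.univ, Measure.restrict_univ]
  have h1 : ∀ x, ENNReal.ofReal (g x)
      = (Set.Ioo (-c) c).indicator (fun x => ENNReal.ofReal (f x)) x := by
    intro x
    rw [hg]
    by_cases hx : x ∈ Set.Ioo (-c) c <;> simp only [Set.indicator, hx, if_true, if_false,
      ENNReal.ofReal_zero]
  rw [lintegral_congr h1, lintegral_indicator measurableSet_Ioo,
    ← ofReal_integral_eq_lintegral_ofReal (hint.mono_set Set.Ioo_subset_Ioc_self), hval,
    ENNReal.ofReal_one]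
  exact (ae_restrict_iff' measurableSet_Ioo).2 (Eventually.of_forall hpos)

theorem konno_isProbabilityMeasure {a : ℝ} (ha : 0 < a) (ha' : a < 1) :
    IsProbabilityMeasure (volume.withDensity fun x => ENNReal.ofReal (konnoDensity a x)) := by
  have hb : 0 < 1 - a ^ 2 := by nlinarith
  have hsb : 0 < √(1 - a ^ 2) := Real.sqrt_pos.2 hb
  have hbb : √(1 - a ^ 2) ^ 2 = 1 - a ^ 2 := Real.sq_sqrt hb.le
  have hx1 : ∀ x ∈ Set.Icc (-a) a, 0 < 1 - x ^ 2 := by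
    intro x hx
    nlinarith [hx.1, hx.2]
  have hxa : ∀ x ∈ Set.Ioo (-a) a, 0 < a ^ 2 - x ^ 2 := by
    intro x hx
    nlinarith [hx.1, hx.2]
  refine isProbabilityMeasure_of_primitive ha
    (F := fun x => Real.arcsin (√(1 - a ^ 2) / a * (x / √(1 - x ^ 2))) / Real.pi)
    (f := fun x => √(1 - a ^ 2) / (Real.pi * (1 - x ^ 2) * √(a ^ 2 - x ^ 2))) ?_ ?_ ?_ ?_ ?_
  · refine ContinuousOn.div_const (Real.continuous_arcsin.comp_continuousOn ?_) _
    refine continuousOn_const.mul (continuousOn_id.div ?_ ?_)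
    · exact Continuous.continuousOn (by fun_prop)
    · intro x hx
      exact (Real.sqrt_pos.2 (hx1 x hx)).ne'
  · intro x hx
    have h1 := hx1 x (Set.Ioo_subset_Icc_self hx)
    have h2 := hxa x hx
    set s := √(1 - x ^ 2) with hs
    set t := √(a ^ 2 - x ^ 2) with ht
    set b := √(1 - a ^ 2) with hbdef
    have hs0 : 0 < s := Real.sqrt_pos.2 h1
    have ht0 : 0 < t := Real.sqrt_pos.2 h2
    have hs2 : s ^ 2 = 1 - x ^ 2 := Real.sq_sqrt h1.le
    have ht2 : t ^ 2 = a ^ 2 - x ^ 2 := Real.sq_sqrt h2.le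
    have hu : 1 - (b / a * (x / s)) ^ 2 = (t / (a * s)) ^ 2 := by
      field_simp
      rw [ht2, hbb, hs2]
      ring
    have hupos : 0 < 1 - (b / a * (x / s)) ^ 2 := by rw [hu]; positivity
    have hd1 : HasDerivAt (fun y : ℝ => √(1 - y ^ 2)) (-x / s) x := by
      refine (((hasDerivAt_pow 2 x).const_sub 1).sqrt h1.ne').congr_deriv ?_
      rw [← hs]
      field_simp
      norm_num
    have hd2 : HasDerivAt (fun y : ℝ => b / a * (y / √(1 - y ^ 2))) (b / a * (1 / s ^ 3)) x := by
      refine (((hasDerivAt_id' x).div hd1 hs0.ne').const_mul (b / a)).congr_deriv ?_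
      rw [← hs]
      field_simp
      rw [hs2]
      ring
    have h3 := ((Real.hasDerivAt_arcsin (x := b / a * (x / s)) (by nlinarith)
      (by nlinarith)).comp x hd2).div_const Real.pi
    refine h3.congr_deriv ?_
    rw [hu, Real.sqrt_sq (by positivity), ← hs2]
    field_simp
  · intro x hx
    have h1 := hx1 x (Set.Ioo_subset_Icc_self hx)
    have := Real.pi_pos
    positivity
  · have e1 : √(1 - a ^ 2) / a * (a / √(1 - a ^ 2)) = 1 := by field_simp
    have e2 : √(1 - a ^ 2) / a * (-a / √(1 - (-a) ^ 2)) = -1 := by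
      rw [neg_sq]
      field_simp
    simp only [e1, e2, Real.arcsin_one, Real.arcsin_neg_one]
    field_simp
    ring
  · intro x
    simp only [konnoDensity, abs_of_pos ha]

theorem two_re_mul_conj (qL qR : ℂ) :
    (qL * conj qR + conj qL * qR).re = 2 * (qL.re * qR.re + qL.im * qR.im) := by
  simp
  ring

theorem abs_two_re_le {qL qR : ℂ} (hq : ‖qL‖ ^ 2 + ‖qR‖ ^ 2 = 1) :
    |(qL * conj qR + conj qL * qR).re| ≤ 1 := by
  rw [two_re_mul_conj]
  rw [← Complex.normSq_eq_norm_sq, ← Complex.normSq_eq_norm_sq, Complex.normSq_apply,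
    Complex.normSq_apply] at hq
  rw [abs_le]
  constructor
  · nlinarith [sq_nonneg (qL.re + qR.re), sq_nonneg (qL.im + qR.im)]
  · nlinarith [sq_nonneg (qL.re - qR.re), sq_nonneg (qL.im - qR.im)]

theorem arcsine_isProbabilityMeasure {qL qR : ℂ} (hq : ‖qL‖ ^ 2 + ‖qR‖ ^ 2 = 1) {r : ℝ}
    (hr : 0 < r) :
    IsProbabilityMeasure
      (volume.withDensity fun x => ENNReal.ofReal (arcsineDensity qL qR r x)) := by
  set κ : ℝ := (qL * conj qR + conj qL * qR).re with hκ
  have hκ1 : |κ| ≤ 1 := abs_two_re_le hq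
  have hxr : ∀ x ∈ Set.Ioo (-r) r, 0 < r ^ 2 - x ^ 2 := by
    intro x hx
    nlinarith [hx.1, hx.2]
  refine isProbabilityMeasure_of_primitive hr
    (F := fun x => (Real.arcsin (x / r) + κ / r * √(r ^ 2 - x ^ 2)) / Real.pi)
    (f := fun x => (1 - κ * x / r) * (1 / (Real.pi * √(r ^ 2 - x ^ 2)))) ?_ ?_ ?_ ?_ ?_
  · refine Continuous.continuousOn ?_
    have := Real.continuous_arcsin.comp (continuous_id.div_const r)
    simp only [Function.comp_def, id] at this
    fun_prop
  · intro x hx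
    have h2 := hxr x hx
    set t := √(r ^ 2 - x ^ 2) with ht
    have ht0 : 0 < t := Real.sqrt_pos.2 h2
    have ht2 : t ^ 2 = r ^ 2 - x ^ 2 := Real.sq_sqrt h2.le
    have hu : 1 - (x / r) ^ 2 = (t / r) ^ 2 := by
      field_simp
      rw [ht2]
    have hupos : 0 < 1 - (x / r) ^ 2 := by rw [hu]; positivity
    have hd1 : HasDerivAt (fun y : ℝ => √(r ^ 2 - y ^ 2)) (-x / t) x := by
      refine (((hasDerivAt_pow 2 x).const_sub (r ^ 2)).sqrt h2.ne').congr_deriv ?_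
      rw [← ht]
      field_simp
      norm_num
    have hd2 := (Real.hasDerivAt_arcsin (x := x / r) (by nlinarith) (by nlinarith)).comp x
      ((hasDerivAt_id x).div_const r)
    have h3 := (hd2.add (hd1.const_mul (κ / r))).div_const Real.pi
    refine h3.congr_deriv ?_
    rw [hu, Real.sqrt_sq (by positivity)]
    field_simp
    ring
  · intro x hx
    have h2 := hxr x hx
    have h4 : κ * x / r ≤ 1 := by
      rw [div_le_one hr]
      calc κ * x ≤ |κ * x| := le_abs_self _
        _ = |κ| * |x| := abs_mul _ _
        _ ≤ 1 * r := mul_le_mul hκ1 (abs_lt.2 hx).le (abs_nonneg _) zero_le_one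
        _ = r := one_mul r
    have := Real.pi_pos
    have h5 : 0 ≤ 1 - κ * x / r := by linarith
    positivity
  · simp only [neg_sq, sub_self, Real.sqrt_zero, mul_zero, add_zero, div_self hr.ne',
      neg_div, Real.arcsin_one, Real.arcsin_neg_one]
    field_simp
    ring
  · intro x
    simp only [arcsineDensity, abs_of_pos hr, Set.indicator_apply, ← hκ]
    split_ifs <;> simp

/-- The law `K(a)`, for `0 < a < 1`. -/
def konnoLaw (a : ℝ) (ha : 0 < a) (ha' : a < 1) : ProbabilityMeasure ℝ :=
  ⟨volume.withDensity fun x => ENNReal.ofReal (konnoDensity a x),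
    konno_isProbabilityMeasure ha ha'⟩

/-- The law `A^φ(r)` for `φ = q_L e_L + q_R e_R`. -/
def arcsineLaw (qL qR : ℂ) (hq : ‖qL‖ ^ 2 + ‖qR‖ ^ 2 = 1) (r : ℝ) (hr : 0 < r) :
    ProbabilityMeasure ℝ :=
  ⟨volume.withDensity fun x => ENNReal.ofReal (arcsineDensity qL qR r x),
    arcsine_isProbabilityMeasure hq hr⟩

/-- The law of `X / c` for an integer-valued `X` with law `p`. -/
def scaledLaw (p : PMF ℤ) (c : ℝ) : ProbabilityMeasure ℝ :=
  ⟨p.toMeasure.map fun x : ℤ => (x : ℝ) / c,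
    Measure.isProbabilityMeasure_map (measurable_of_countable _).aemeasurable⟩

/-- The Bessel function of the first kind of integer order `m`. Terms with `m + k < 0` vanish,
as `Real.Gamma` is `0` at the non-positive integers (in accordance with `1 / Γ = 0` there). -/
def besselJ (m : ℤ) (z : ℝ) : ℝ :=
  ∑' k : ℕ, (-1) ^ k / ((k.factorial : ℝ) * Real.Gamma ((m : ℝ) + k + 1)) *
    (z / 2) ^ (m + 2 * (k : ℤ))

/-- The function `𝒥(x; t)`; the factor `q̄_R q_L + q_R q̄_L` is real. -/
def besselProfile (qL qR : ℂ) (x : ℤ) (t : ℝ) : ℝ :=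
  (1 - (conj qR * qL + qR * conj qL).re * (2 * x / t)) * besselJ x t ^ 2
    + ‖qL‖ ^ 2 * besselJ (x - 1) t ^ 2 + ‖qR‖ ^ 2 * besselJ (x + 1) t ^ 2

end QW

end

noncomputable section

namespace QW

/-! ### The walk in Fourier space -/

/-! On the Fourier side, one step of the walk with `a = √(ρ n)` is multiplication by `diag(e^{-ik},
e^{ik}) H`, a unitary matrix of determinant `-1` and trace `-2 i a sin k`. With `θ = arcsin (a sin
k)` its eigenvalues are `e^{-iθ}` and `-e^{iθ}`, and the eigenprojections are `(1 ± N) / 2` for a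
self-adjoint involution `N`. Hence the transform after `n` steps is the closed form `waveFn`, and
every limit becomes an integral over `[-π, π]` handled by dominated convergence.

Weak limits (`α < 1`). By Parseval, the characteristic function at `ξ` is the mean over `k` of the
inner product of the transforms at `k` and `k + ξ / c`, where `c = n^{1-α}`. Since `n a = r c`, the
phase increment `n (θ(k + ξ/c) - θ(k))` tends to `r ξ v(k)`, where `v(k) = cos k / √(1 - A² sin² k)`
and `A = lim a`; thus `A = r` if `α = 0` and `A = 0` otherwise. Terms mixing the two eigenvectors
vanish by orthogonality. The symmetries `k ↦ k + π` and `k ↦ -k` reduce the limit to an integral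
over `[0, π]` with weight `1 - drift * v`, and the substitution `x = r v(k)` turns it into the
characteristic function of the stated law. For `α = 0` the symmetric initial state makes the drift
vanish. Lévy's continuity theorem concludes.

Local limits (`α ≥ 1`). Here `n a → t`, with `t = r` or `t = 0`, so `n θ(k) → t sin k` and `N` tends
to its value at `a = 0`. Fourier inversion turns the two branches into Bessel integrals. They give
the same vector `besselVec` with signs `(-1)^x` and `(-1)^n`, and their interference is the parity
factor. The three-term recurrence identifies the squared norm with `besselProfile`. For the
asymptotic equivalence the profile must be positive: it is a sum of two squares whose common
vanishing is a linear system in `(q_L, q_R)` with determinant `J_x² - J_{x-1} J_{x+1}`, positive by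
Turán's inequality. At `t = 0` only `J_0` survives, which gives the last regime. -/

/-- The reflection `N` with `diag(e^{-ik}, e^{ik}) H = -i a sin k + √(1 - a² sin² k) N`. -/
def refl (a k : ℝ) (φ : Fin 2 → ℂ) : Fin 2 → ℂ :=
  ![((a * Real.cos k : ℝ) * φ 0 + (√(1 - a ^ 2) : ℝ) * Complex.exp (-(k * Complex.I)) * φ 1) /
      (√(1 - (a * Real.sin k) ^ 2) : ℝ),
    ((√(1 - a ^ 2) : ℝ) * Complex.exp (k * Complex.I) * φ 0 - (a * Real.cos k : ℝ) * φ 1) /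
      (√(1 - (a * Real.sin k) ^ 2) : ℝ)]

/-- The eigencomponents `(1 ± N) φ / 2` of `φ`, for `σ = ±1`. -/
def branch (σ : ℂ) (a k : ℝ) (φ : Fin 2 → ℂ) : Fin 2 → ℂ :=
  fun j => (φ j + σ * refl a k φ j) / 2

theorem exp_mul_I_real (k : ℝ) :
    Complex.exp (k * Complex.I) = (Real.cos k : ℝ) + (Real.sin k : ℝ) * Complex.I := by
  rw [Complex.exp_mul_I]; simp

theorem exp_neg_mul_I_real (k : ℝ) :
    Complex.exp (-(k * Complex.I)) = (Real.cos k : ℝ) - (Real.sin k : ℝ) * Complex.I := by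
  rw [← neg_mul, Complex.exp_mul_I]; simp [sub_eq_add_neg]

theorem sq_mul_sin_lt_one {a : ℝ} (ha : |a| < 1) (k : ℝ) : (a * Real.sin k) ^ 2 < 1 := by
  have h1 : a ^ 2 < 1 := (sq_lt_one_iff_abs_lt_one a).2 ha
  have h2 := Real.sin_sq_le_one k
  rw [mul_pow]
  nlinarith [sq_nonneg a, sq_nonneg (Real.sin k)]

theorem sqrt_one_sub_pos {a : ℝ} (ha : |a| < 1) (k : ℝ) : 0 < √(1 - (a * Real.sin k) ^ 2) :=
  Real.sqrt_pos.2 (sub_pos.2 (sq_mul_sin_lt_one ha k))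

theorem ofReal_sqrt_ne_zero {a : ℝ} (ha : |a| < 1) (k : ℝ) :
    ((√(1 - (a * Real.sin k) ^ 2) : ℝ) : ℂ) ≠ 0 :=
  Complex.ofReal_ne_zero.2 (sqrt_one_sub_pos ha k).ne'

theorem ofReal_sqrt_sq {a : ℝ} (ha : |a| < 1) (k : ℝ) :
    ((√(1 - (a * Real.sin k) ^ 2) : ℝ) : ℂ) ^ 2 = 1 - (a : ℂ) ^ 2 * (Real.sin k : ℝ) ^ 2 := by
  rw [← Complex.ofReal_pow, Real.sq_sqrt (sub_pos.2 (sq_mul_sin_lt_one ha k)).le]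
  push_cast; ring

theorem ofReal_sqrt_one_sub_sq {a : ℝ} (ha : |a| < 1) :
    ((√(1 - a ^ 2) : ℝ) : ℂ) ^ 2 = 1 - (a : ℂ) ^ 2 := by
  rw [← Complex.ofReal_pow, Real.sq_sqrt
    (sub_pos.2 ((sq_lt_one_iff_abs_lt_one a).2 ha)).le]
  push_cast; ring

theorem ofReal_cos_sq_add_sin_sq (k : ℝ) :
    ((Real.cos k : ℝ) : ℂ) ^ 2 + ((Real.sin k : ℝ) : ℂ) ^ 2 = 1 := by
  exact_mod_cast Real.cos_sq_add_sin_sq k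

/-- The numerator matrix of `N` is traceless and squares to `a² cos² k + 1 - a² = 1 - a² sin² k`,
the square of the denominator. -/
theorem refl_refl {a : ℝ} (ha : |a| < 1) (k : ℝ) (φ : Fin 2 → ℂ) :
    refl a k (refl a k φ) = φ := by
  have hD := ofReal_sqrt_ne_zero ha k
  have hD2 := ofReal_sqrt_sq ha k
  have hb := ofReal_sqrt_one_sub_sq ha
  have hcs := ofReal_cos_sq_add_sin_sq k
  have hI := Complex.I_sq
  simp only [refl, exp_mul_I_real, exp_neg_mul_I_real]
  generalize ((√(1 - (a * Real.sin k) ^ 2) : ℝ) : ℂ) = D at *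
  generalize ((√(1 - a ^ 2) : ℝ) : ℂ) = b at *
  push_cast
  simp only [← Complex.ofReal_cos, ← Complex.ofReal_sin] at *
  generalize ((Real.cos k : ℝ) : ℂ) = c at *
  generalize ((Real.sin k : ℝ) : ℂ) = s at *
  have key : (a * c) ^ 2 + b ^ 2 * ((c + s * Complex.I) * (c - s * Complex.I)) = D ^ 2 := by
    linear_combination (c ^ 2 - s ^ 2 * Complex.I ^ 2) * hb - hD2 + hcs
      - s ^ 2 * (1 - a ^ 2 : ℂ) * hI
  ext j
  fin_cases j
  · simp
    field_simp
    linear_combination φ 0 * key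
  · simp
    field_simp
    linear_combination φ 1 * key

/-- With `fourier_step_one`, this splits the one-step matrix into half its trace, a scalar, plus a
multiple of `N`, so that diagonalizing `N` diagonalizes the step. -/
theorem fourier_step_zero {a : ℝ} (ha : |a| < 1) (k : ℝ) (φ : Fin 2 → ℂ) :
    Complex.exp (-(k * Complex.I)) * (a * φ 0 + (√(1 - a ^ 2) : ℝ) * φ 1) =
      -(Complex.I * (a * Real.sin k : ℝ)) * φ 0
        + (√(1 - (a * Real.sin k) ^ 2) : ℝ) * refl a k φ 0 := by
  have hD := ofReal_sqrt_ne_zero ha k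
  simp only [refl, Matrix.cons_val_zero]
  rw [mul_div_cancel₀ _ hD, exp_neg_mul_I_real]
  push_cast
  ring

theorem fourier_step_one {a : ℝ} (ha : |a| < 1) (k : ℝ) (φ : Fin 2 → ℂ) :
    Complex.exp (k * Complex.I) * ((√(1 - a ^ 2) : ℝ) * φ 0 - a * φ 1) =
      -(Complex.I * (a * Real.sin k : ℝ)) * φ 1
        + (√(1 - (a * Real.sin k) ^ 2) : ℝ) * refl a k φ 1 := by
  have hD := ofReal_sqrt_ne_zero ha k
  simp only [refl, Matrix.cons_val_one, Matrix.cons_val_zero]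
  rw [mul_div_cancel₀ _ hD, exp_mul_I_real]
  push_cast
  ring

theorem refl_branch {σ : ℂ} (hσ : σ * σ = 1) {a : ℝ} (ha : |a| < 1) (k : ℝ) (φ : Fin 2 → ℂ) :
    refl a k (branch σ a k φ) = fun j => σ * branch σ a k φ j := by
  have h := refl_refl ha k φ
  have hlin : ∀ u v : Fin 2 → ℂ, refl a k (fun j => (u j + σ * v j) / 2) =
      fun j => (refl a k u j + σ * refl a k v j) / 2 := by
    intro u v
    ext j
    fin_cases j <;> simp [refl] <;> ring
  unfold branch
  rw [hlin, h]
  ext j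
  linear_combination (-refl a k φ j / 2) * hσ

theorem branch_add (a k : ℝ) (φ : Fin 2 → ℂ) (j : Fin 2) :
    branch 1 a k φ j + branch (-1) a k φ j = φ j := by
  simp only [branch]; ring

/-- The Fourier transform of the walk after `n` steps. -/
def waveFn (a : ℝ) (φ : Fin 2 → ℂ) (n : ℕ) (k : ℝ) (j : Fin 2) : ℂ :=
  Complex.exp (-((n * Real.arcsin (a * Real.sin k) : ℝ) * Complex.I)) * branch 1 a k φ j
    + (-1) ^ n * Complex.exp ((n * Real.arcsin (a * Real.sin k) : ℝ) * Complex.I) *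
      branch (-1) a k φ j

theorem exp_arcsin (y : ℝ) (h : y ^ 2 ≤ 1) :
    Complex.exp ((Real.arcsin y : ℝ) * Complex.I) = (√(1 - y ^ 2) : ℝ) + (y : ℝ) * Complex.I := by
  have := abs_le.1 ((sq_le_one_iff_abs_le_one y).1 h)
  rw [exp_mul_I_real, Real.cos_arcsin, Real.sin_arcsin this.1 this.2]

theorem exp_neg_arcsin (y : ℝ) (h : y ^ 2 ≤ 1) :
    Complex.exp (-((Real.arcsin y : ℝ) * Complex.I)) =
      (√(1 - y ^ 2) : ℝ) - (y : ℝ) * Complex.I := by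
  have := abs_le.1 ((sq_le_one_iff_abs_le_one y).1 h)
  rw [exp_neg_mul_I_real, Real.cos_arcsin, Real.sin_arcsin this.1 this.2]

/-- On the eigenspaces `N = 1` and `N = -1` the step is the scalar `-i sin θ ± cos θ`, that is
`e^{-iθ}` and `-e^{iθ}`; the second one produces the sign `(-1)^n`. -/
theorem waveFn_eq_refl {a : ℝ} (ha : |a| < 1) (φ : Fin 2 → ℂ) (n : ℕ) (k : ℝ) (j : Fin 2) :
    -(Complex.I * (a * Real.sin k : ℝ)) * waveFn a φ n k j
        + (√(1 - (a * Real.sin k) ^ 2) : ℝ) * refl a k (waveFn a φ n k) j =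
      waveFn a φ (n + 1) k j := by
  set p := Complex.exp (-((n * Real.arcsin (a * Real.sin k) : ℝ) * Complex.I)) with hp
  set m := (-1) ^ n * Complex.exp ((n * Real.arcsin (a * Real.sin k) : ℝ) * Complex.I) with hm
  have hlin : refl a k (waveFn a φ n k) j =
      p * refl a k (branch 1 a k φ) j + m * refl a k (branch (-1) a k φ) j := by
    fin_cases j <;> simp [refl, waveFn, hp, hm] <;> ring
  rw [hlin, refl_branch (by norm_num) ha, refl_branch (by norm_num) ha]
  have hy := (sq_mul_sin_lt_one ha k).le
  have e1 := exp_neg_arcsin _ hy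
  have e2 := exp_arcsin _ hy
  have h1 : Complex.exp (-(((n + 1 : ℕ) * Real.arcsin (a * Real.sin k) : ℝ) * Complex.I)) =
      p * Complex.exp (-((Real.arcsin (a * Real.sin k) : ℝ) * Complex.I)) := by
    rw [hp, ← Complex.exp_add]; congr 1; push_cast; ring
  have h2 : (-1) ^ (n + 1) * Complex.exp (((n + 1 : ℕ) * Real.arcsin (a * Real.sin k) : ℝ)
      * Complex.I) = -m * Complex.exp ((Real.arcsin (a * Real.sin k) : ℝ) * Complex.I) := by
    rw [hm, neg_mul, mul_assoc, ← Complex.exp_add, pow_succ]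
    rw [show ((n : ℝ) * Real.arcsin (a * Real.sin k) : ℝ) * Complex.I
      + (Real.arcsin (a * Real.sin k) : ℝ) * Complex.I
      = (((n + 1 : ℕ) : ℝ) * Real.arcsin (a * Real.sin k) : ℝ) * Complex.I by push_cast; ring]
    ring
  have h3 : waveFn a φ n k j = p * branch 1 a k φ j + m * branch (-1) a k φ j := rfl
  rw [h3]
  simp only [waveFn]
  rw [h1, h2, e1, e2]
  ring

theorem waveFn_zero (a : ℝ) (φ : Fin 2 → ℂ) (k : ℝ) (j : Fin 2) : waveFn a φ 0 k j = φ j := by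
  simp [waveFn, branch_add]

theorem amplitude_succ_left (H : Matrix (Fin 2) (Fin 2) ℂ) (φ : Fin 2 → ℂ) (m : ℕ) (x : ℤ) :
    amplitude H φ (m + 1) x 0 = (H *ᵥ amplitude H φ m (x + 1)) 0 := by
  rw [amplitude, matP_mulVec, matQ_mulVec]; simp

theorem amplitude_succ_right (H : Matrix (Fin 2) (Fin 2) ℂ) (φ : Fin 2 → ℂ) (m : ℕ) (x : ℤ) :
    amplitude H φ (m + 1) x 1 = (H *ᵥ amplitude H φ m (x - 1)) 1 := by
  rw [amplitude, matP_mulVec, matQ_mulVec]; simp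

theorem ftdCoin_mulVec_zero (ρ : unitInterval) (v : Fin 2 → ℂ) :
    ((ftdCoin ρ : Matrix (Fin 2) (Fin 2) ℂ) *ᵥ v) 0 =
      (√(ρ : ℝ) : ℝ) * v 0 + (√(1 - √(ρ : ℝ) ^ 2) : ℝ) * v 1 := by
  rw [Real.sq_sqrt ρ.2.1]
  simp [ftdCoin, Matrix.mulVec, dotProduct, Fin.sum_univ_two]

theorem ftdCoin_mulVec_one (ρ : unitInterval) (v : Fin 2 → ℂ) :
    ((ftdCoin ρ : Matrix (Fin 2) (Fin 2) ℂ) *ᵥ v) 1 =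
      (√(1 - √(ρ : ℝ) ^ 2) : ℝ) * v 0 - (√(ρ : ℝ) : ℝ) * v 1 := by
  rw [Real.sq_sqrt ρ.2.1]
  simp [ftdCoin, Matrix.mulVec, dotProduct, Fin.sum_univ_two, sub_eq_add_neg]

/-- Induction on time: the shifts by one site become the factors `e^{∓ik}`. The bound on `√ρ` keeps
the denominator of `refl` away from zero. -/
theorem hasSum_amplitude (ρ : unitInterval) (hρ : √(ρ : ℝ) < 1) (φ : Fin 2 → ℂ) (n : ℕ) (k : ℝ)
    (j : Fin 2) :
    HasSum (fun x : ℤ => Complex.exp (x * (k * Complex.I)) * amplitude (ftdCoin ρ) φ n x j)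
      (waveFn √(ρ : ℝ) φ n k j) := by
  have ha : |√(ρ : ℝ)| < 1 := by rwa [abs_of_nonneg (Real.sqrt_nonneg _)]
  induction n generalizing j with
  | zero =>
    rw [waveFn_zero]
    convert hasSum_ite_eq (0 : ℤ) (φ j) using 1
    funext x
    by_cases hx : x = 0 <;> simp [amplitude, hx]
  | succ n ih =>
    rw [← waveFn_eq_refl ha]
    fin_cases j
    · simp only [Fin.zero_eta]
      rw [← fourier_step_zero ha]
      have h := (((ih 0).mul_left ((√(ρ : ℝ) : ℝ) : ℂ)).add
        ((ih 1).mul_left ((√(1 - √(ρ : ℝ) ^ 2) : ℝ) : ℂ))).mul_left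
          (Complex.exp (-(k * Complex.I)))
      rw [← (Equiv.addRight (1 : ℤ)).hasSum_iff] at h
      refine Eq.subst (motive := fun f => HasSum f _) (funext fun x => ?_) h
      symm
      simp only [Function.comp, Equiv.coe_addRight, amplitude_succ_left, ftdCoin_mulVec_zero]
      have : Complex.exp (-(k * Complex.I)) * Complex.exp ((x + 1 : ℤ) * (k * Complex.I)) =
          Complex.exp (x * (k * Complex.I)) := by
        rw [← Complex.exp_add]; congr 1; push_cast; ring
      rw [← this]
      ring
    · simp only [Fin.mk_one]
      rw [← fourier_step_one ha]
      have h := (((ih 0).mul_left ((√(1 - √(ρ : ℝ) ^ 2) : ℝ) : ℂ)).sub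
        ((ih 1).mul_left ((√(ρ : ℝ) : ℝ) : ℂ))).mul_left (Complex.exp (k * Complex.I))
      rw [← (Equiv.subRight (1 : ℤ)).hasSum_iff] at h
      refine Eq.subst (motive := fun f => HasSum f _) (funext fun x => ?_) h
      symm
      simp only [Function.comp, Equiv.subRight_apply, amplitude_succ_right, ftdCoin_mulVec_one]
      have : Complex.exp (k * Complex.I) * Complex.exp ((x - 1 : ℤ) * (k * Complex.I)) =
          Complex.exp (x * (k * Complex.I)) := by
        rw [← Complex.exp_add]; congr 1; push_cast; ring
      rw [← this]
      ring

/-- Propagation at unit speed. It makes the Fourier series a finite sum, so sums and integrals may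
be exchanged freely. -/
theorem amplitude_eq_zero_of_lt (H : Matrix (Fin 2) (Fin 2) ℂ) (φ : Fin 2 → ℂ) (n : ℕ) (x : ℤ)
    (hx : (n : ℤ) < |x|) : amplitude H φ n x = 0 := by
  induction n generalizing x with
  | zero =>
    have : x ≠ 0 := by rintro rfl; simp at hx
    simp [amplitude, this]
  | succ n ih =>
    push_cast at hx
    rw [amplitude, ih _ (by grind), ih _ (by grind)]
    simp

theorem amplitude_eq_zero_of_odd (H : Matrix (Fin 2) (Fin 2) ℂ) (φ : Fin 2 → ℂ) (n : ℕ) (x : ℤ)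
    (hx : Odd ((n : ℤ) + x)) : amplitude H φ n x = 0 := by
  induction n generalizing x with
  | zero =>
    have : x ≠ 0 := by rintro rfl; simp at hx
    simp [amplitude, this]
  | succ n ih =>
    push_cast at hx
    rw [amplitude, ih _ (by grind), ih _ (by grind)]
    simp

theorem waveFn_eq_sum (ρ : unitInterval) (hρ : √(ρ : ℝ) < 1) (φ : Fin 2 → ℂ) (n : ℕ) (k : ℝ)
    (j : Fin 2) :
    waveFn √(ρ : ℝ) φ n k j = ∑ x ∈ Finset.Icc (-n : ℤ) n,
      Complex.exp (x * (k * Complex.I)) * amplitude (ftdCoin ρ) φ n x j := by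
  refine (hasSum_amplitude ρ hρ φ n k j).unique (hasSum_sum_of_ne_finset_zero fun x hx => ?_)
  rw [amplitude_eq_zero_of_lt]
  · simp
  · rw [Finset.mem_Icc] at hx
    grind

theorem integral_exp_int (m : ℤ) :
    ∫ k in (-Real.pi)..Real.pi, Complex.exp (m * (k * Complex.I)) =
      if m = 0 then (2 * Real.pi : ℂ) else 0 := by
  split_ifs with h
  · simp [h]; ring
  · have hc : (m : ℂ) * Complex.I ≠ 0 := mul_ne_zero (by exact_mod_cast h) Complex.I_ne_zero
    have e : ∀ k : ℝ, Complex.exp (m * (k * Complex.I)) = Complex.exp (m * Complex.I * k) :=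
      fun k => by congr 1; ring
    simp_rw [e]
    rw [integral_exp_mul_complex hc, div_eq_zero_iff]
    left
    rw [sub_eq_zero, Complex.exp_eq_exp_iff_exists_int]
    exact ⟨m, by push_cast; ring⟩

theorem integral_waveFn (ρ : unitInterval) (hρ : √(ρ : ℝ) < 1) (φ : Fin 2 → ℂ) (n : ℕ) (x : ℤ)
    (j : Fin 2) :
    ∫ k in (-Real.pi)..Real.pi, Complex.exp (-(x * (k * Complex.I))) * waveFn √(ρ : ℝ) φ n k j =
      2 * Real.pi * amplitude (ftdCoin ρ) φ n x j := by
  have h : ∀ k : ℝ, Complex.exp (-(x * (k * Complex.I))) * waveFn √(ρ : ℝ) φ n k j =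
      ∑ y ∈ Finset.Icc (-n : ℤ) n, Complex.exp ((y - x : ℤ) * (k * Complex.I)) *
        amplitude (ftdCoin ρ) φ n y j := by
    intro k
    rw [waveFn_eq_sum ρ hρ, Finset.mul_sum]
    refine Finset.sum_congr rfl fun y _ => ?_
    rw [← mul_assoc, ← Complex.exp_add]
    congr 2
    push_cast; ring
  simp_rw [h]
  rw [intervalIntegral.integral_finsetSum
    fun y _ => Continuous.intervalIntegrable (by fun_prop) _ _]
  simp_rw [intervalIntegral.integral_mul_const, integral_exp_int, sub_eq_zero, ite_mul, zero_mul]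
  rw [Finset.sum_ite_eq']
  split_ifs with hx
  · rfl
  · rw [amplitude_eq_zero_of_lt]
    · simp
    · rw [Finset.mem_Icc] at hx
      grind

/-- Parseval's identity for the generating function of the law of the walk. -/
theorem integral_conj_waveFn_mul (ρ : unitInterval) (hρ : √(ρ : ℝ) < 1) (φ : Fin 2 → ℂ) (n : ℕ)
    (h : ℝ) :
    ∫ k in (-Real.pi)..Real.pi,
        ∑ j, conj (waveFn √(ρ : ℝ) φ n k j) * waveFn √(ρ : ℝ) φ n (k + h) j =
      2 * Real.pi * ∑ x ∈ Finset.Icc (-n : ℤ) n,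
        Complex.exp (x * (h * Complex.I)) * (prob (ftdCoin ρ) φ n x : ℝ) := by
  set A := amplitude (ftdCoin ρ) φ n with hA
  set S := Finset.Icc (-n : ℤ) n with hS
  have key : ∀ k : ℝ,
      ∑ j, conj (waveFn √(ρ : ℝ) φ n k j) * waveFn √(ρ : ℝ) φ n (k + h) j =
      ∑ j, ∑ x ∈ S, ∑ y ∈ S, Complex.exp ((y - x : ℤ) * (k * Complex.I)) *
        (conj (A x j) * (Complex.exp (y * (h * Complex.I)) * A y j)) := by
    intro k
    refine Finset.sum_congr rfl fun j _ => ?_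
    rw [waveFn_eq_sum ρ hρ, waveFn_eq_sum ρ hρ, map_sum, Finset.sum_mul_sum]
    refine Finset.sum_congr rfl fun x _ => Finset.sum_congr rfl fun y _ => ?_
    rw [map_mul, ← Complex.exp_conj]
    have : Complex.exp ((y - x : ℤ) * (k * Complex.I)) * Complex.exp (y * (h * Complex.I)) =
        Complex.exp (conj (x * (k * Complex.I))) *
          Complex.exp (y * ((k + h : ℝ) * Complex.I)) := by
      rw [← Complex.exp_add, ← Complex.exp_add]
      congr 1
      simp
      ring
    linear_combination (-(conj (A x j) * A y j)) * this
  simp_rw [key]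
  rw [intervalIntegral.integral_finsetSum
    fun j _ => Continuous.intervalIntegrable (by fun_prop) _ _]
  have e1 : ∀ j, ∫ k in (-Real.pi)..Real.pi, ∑ x ∈ S, ∑ y ∈ S,
      Complex.exp ((y - x : ℤ) * (k * Complex.I)) *
        (conj (A x j) * (Complex.exp (y * (h * Complex.I)) * A y j)) =
      ∑ x ∈ S, ∑ y ∈ S, ∫ k in (-Real.pi)..Real.pi,
        Complex.exp ((y - x : ℤ) * (k * Complex.I)) *
          (conj (A x j) * (Complex.exp (y * (h * Complex.I)) * A y j)) := by
    intro j
    rw [intervalIntegral.integral_finsetSum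
      fun x _ => Continuous.intervalIntegrable (by fun_prop) _ _]
    exact Finset.sum_congr rfl fun x _ => intervalIntegral.integral_finsetSum
      fun y _ => Continuous.intervalIntegrable (by fun_prop) _ _
  simp_rw [e1, intervalIntegral.integral_mul_const, integral_exp_int, sub_eq_zero, ite_mul,
    zero_mul, Finset.sum_ite_eq']
  rw [Finset.sum_comm, Finset.mul_sum]
  refine Finset.sum_congr rfl fun x hx => ?_
  simp only [hx, if_true, prob, ← hA]
  push_cast
  rw [Finset.mul_sum, Finset.mul_sum]
  refine Finset.sum_congr rfl fun j _ => ?_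
  rw [← Complex.conj_mul']
  ring

/-! ### Limits of the Fourier transforms -/

/-- The quadratic form `⟨φ, N φ⟩`. -/
def reflForm (a k : ℝ) (φ : Fin 2 → ℂ) : ℂ := ∑ j, conj (φ j) * refl a k φ j

theorem sum_conj_refl_mul (a k : ℝ) (u v : Fin 2 → ℂ) :
    ∑ j, conj (refl a k u j) * v j = ∑ j, conj (u j) * refl a k v j := by
  simp only [Fin.sum_univ_two, refl, exp_mul_I_real, exp_neg_mul_I_real, Matrix.cons_val_zero,
    Matrix.cons_val_one, map_div₀, map_add, map_sub, map_mul, Complex.conj_ofReal, Complex.conj_I]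
  ring

/-- Uses only that `N` is a self-adjoint involution. For `σ = -τ = ±1` the right side is zero
(orthogonality of the branches); for `σ = τ = ±1` and a unit vector it is `(1 ± ⟨φ, N φ⟩) / 2`. -/
theorem sum_conj_branch_mul {σ τ : ℂ} (hσ : conj σ = σ) {a : ℝ} (ha : |a| < 1) (k : ℝ)
    (φ : Fin 2 → ℂ) :
    ∑ j, conj (branch σ a k φ j) * branch τ a k φ j =
      ((1 + σ * τ) * ∑ j, conj (φ j) * φ j + (σ + τ) * reflForm a k φ) / 4 := by
  have h1 := sum_conj_refl_mul a k φ φ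
  have h2 := sum_conj_refl_mul a k φ (refl a k φ)
  rw [refl_refl ha] at h2
  simp only [branch, reflForm, Fin.sum_univ_two, map_div₀, map_add, map_mul, hσ, map_ofNat] at *
  linear_combination (σ / 4) * h1 + (σ * τ / 4) * h2

theorem sum_conj_mul_self {φ : Fin 2 → ℂ} (hφ : ∑ j, ‖φ j‖ ^ 2 = 1) :
    ∑ j, conj (φ j) * φ j = 1 := by
  simp_rw [Complex.conj_mul']
  exact_mod_cast hφ

/-- Pythagoras for the two eigencomponents. It bounds the branches uniformly in `a` and `k`, as
dominated convergence requires. -/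
theorem sum_sq_branch {a : ℝ} (ha : |a| < 1) (k : ℝ) {φ : Fin 2 → ℂ}
    (hφ : ∑ j, ‖φ j‖ ^ 2 = 1) :
    ∑ j, ‖branch 1 a k φ j‖ ^ 2 + ∑ j, ‖branch (-1) a k φ j‖ ^ 2 = 1 := by
  have h1 := sum_conj_branch_mul (σ := 1) (τ := 1) (by simp) ha k φ
  have h2 := sum_conj_branch_mul (σ := -1) (τ := -1) (by simp) ha k φ
  rw [sum_conj_mul_self hφ] at h1 h2
  simp_rw [Complex.conj_mul'] at h1 h2
  have : ((∑ j, ‖branch 1 a k φ j‖ ^ 2 + ∑ j, ‖branch (-1) a k φ j‖ ^ 2 : ℝ) : ℂ) = 1 := by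
    push_cast
    rw [h1, h2]
    ring
  exact_mod_cast this

theorem norm_branch_one_le {a : ℝ} (ha : |a| < 1) (k : ℝ) {φ : Fin 2 → ℂ}
    (hφ : ∑ j, ‖φ j‖ ^ 2 = 1) (j : Fin 2) : ‖branch 1 a k φ j‖ ≤ 1 := by
  have h := sum_sq_branch ha k hφ
  have h1 := Finset.single_le_sum (f := fun j => ‖branch 1 a k φ j‖ ^ 2)
    (fun i _ => sq_nonneg _) (Finset.mem_univ j)
  have h2 : 0 ≤ ∑ j, ‖branch (-1) a k φ j‖ ^ 2 := Finset.sum_nonneg fun i _ => sq_nonneg _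
  refine (sq_le_one_iff₀ (norm_nonneg _)).1 ?_
  linarith

theorem norm_branch_neg_one_le {a : ℝ} (ha : |a| < 1) (k : ℝ) {φ : Fin 2 → ℂ}
    (hφ : ∑ j, ‖φ j‖ ^ 2 = 1) (j : Fin 2) : ‖branch (-1) a k φ j‖ ≤ 1 := by
  have h := sum_sq_branch ha k hφ
  have h1 := Finset.single_le_sum (f := fun j => ‖branch (-1) a k φ j‖ ^ 2)
    (fun i _ => sq_nonneg _) (Finset.mem_univ j)
  have h2 : 0 ≤ ∑ j, ‖branch 1 a k φ j‖ ^ 2 := Finset.sum_nonneg fun i _ => sq_nonneg _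
  refine (sq_le_one_iff₀ (norm_nonneg _)).1 ?_
  linarith

theorem norm_exp_neg_ofReal_mul_I (y : ℝ) : ‖Complex.exp (-((y : ℂ) * Complex.I))‖ = 1 := by
  rw [← neg_mul, ← Complex.ofReal_neg, Complex.norm_exp_ofReal_mul_I]

theorem norm_waveFn_le {a : ℝ} (ha : |a| < 1) (n : ℕ) (k : ℝ) {φ : Fin 2 → ℂ}
    (hφ : ∑ j, ‖φ j‖ ^ 2 = 1) (j : Fin 2) : ‖waveFn a φ n k j‖ ≤ 2 := by
  unfold waveFn
  refine (norm_add_le _ _).trans ?_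
  rw [norm_mul, norm_mul, norm_mul, norm_pow, norm_neg, norm_one, one_pow,
    norm_exp_neg_ofReal_mul_I, Complex.norm_exp_ofReal_mul_I]
  linarith [norm_branch_one_le ha k hφ j, norm_branch_neg_one_le ha k hφ j]

theorem continuousAt_refl {a : ℝ} (ha : |a| < 1) (k : ℝ) (φ : Fin 2 → ℂ) (j : Fin 2) :
    ContinuousAt (fun p : ℝ × ℝ => refl p.1 p.2 φ j) (a, k) := by
  have hD := ofReal_sqrt_ne_zero ha k
  fin_cases j
  · simp only [refl, Fin.zero_eta, Matrix.cons_val_zero]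
    exact ContinuousAt.div (by fun_prop) (by fun_prop) hD
  · simp only [refl, Fin.mk_one, Matrix.cons_val_one]
    exact ContinuousAt.div (by fun_prop) (by fun_prop) hD

theorem continuousAt_branch (σ : ℂ) {a : ℝ} (ha : |a| < 1) (k : ℝ) (φ : Fin 2 → ℂ) (j : Fin 2) :
    ContinuousAt (fun p : ℝ × ℝ => branch σ p.1 p.2 φ j) (a, k) :=
  ((continuousAt_const.mul (continuousAt_refl ha k φ j)).const_add _).div_const 2

theorem continuous_branch (σ : ℂ) {a : ℝ} (ha : |a| < 1) (φ : Fin 2 → ℂ) (j : Fin 2) :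
    Continuous fun k => branch σ a k φ j := by
  rw [continuous_iff_continuousAt]
  intro k
  exact (continuousAt_branch σ ha k φ j).comp (f := fun k : ℝ => (a, k)) (by fun_prop)

theorem continuous_waveFn {a : ℝ} (ha : |a| < 1) (φ : Fin 2 → ℂ) (n : ℕ) (j : Fin 2) :
    Continuous fun k => waveFn a φ n k j := by
  have h1 := continuous_branch 1 ha φ j
  have h2 := continuous_branch (-1) ha φ j
  have h3 : Continuous fun k => Real.arcsin (a * Real.sin k) :=
    Real.continuous_arcsin.comp (by fun_prop)
  unfold waveFn
  fun_prop

theorem tendsto_congr_lim {X : Type*} [TopologicalSpace X] {f : ℕ → X} {x y : X}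
    (h : Tendsto f atTop (𝓝 x)) (hxy : x = y) : Tendsto f atTop (𝓝 y) := hxy ▸ h

/-- Both endpoints move with `n`, hence strict differentiability: the error is `o(y n - x n)`, and
`s n * (y n - x n)` is bounded because it converges. -/
theorem tendsto_mul_sub_of_hasStrictDerivAt {F : ℝ → ℝ} {F' c d : ℝ} (hF : HasStrictDerivAt F F' c)
    {s x y : ℕ → ℝ} (hx : Tendsto x atTop (𝓝 c)) (hy : Tendsto y atTop (𝓝 c))
    (hd : Tendsto (fun n => s n * (y n - x n)) atTop (𝓝 d)) :
    Tendsto (fun n => s n * (F (y n) - F (x n))) atTop (𝓝 (d * F')) := by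
  have h1 := hF.hasStrictFDerivAt.isLittleO.comp_tendsto (hy.prodMk_nhds hx)
  have h2 := ((isBigO_refl s atTop).mul_isLittleO h1).trans_isBigO (hd.isBigO_one ℝ)
  have h3 := ((isLittleO_one_iff ℝ).1 h2).add (hd.mul_const F')
  rw [zero_add] at h3
  refine h3.congr fun n => ?_
  simp only [Function.comp, ContinuousLinearMap.toSpanSingleton_apply, smul_eq_mul]
  ring

theorem hasStrictDerivAt_arcsin_mul_sin {a : ℝ} (ha : |a| < 1) (k : ℝ) :
    HasStrictDerivAt Real.arcsin (1 / √(1 - (a * Real.sin k) ^ 2)) (a * Real.sin k) := by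
  have h := sq_mul_sin_lt_one ha k
  refine Real.hasStrictDerivAt_arcsin ?_ ?_ <;> intro h' <;> rw [h'] at h <;> norm_num at h

/-- The previous principle is applied to `sin` with weight `n * a n`, then to `arcsin` with weight
`n`. This order covers `A = 0` as well, where `n * h n` alone may diverge. -/
theorem tendsto_mul_arcsin_sub {a h : ℕ → ℝ} {A d : ℝ} (hA : |A| < 1)
    (ha : Tendsto a atTop (𝓝 A)) (hh : Tendsto h atTop (𝓝 0))
    (hd : Tendsto (fun n : ℕ => n * a n * h n) atTop (𝓝 d)) (k : ℝ) :
    Tendsto (fun n : ℕ => n * (Real.arcsin (a n * Real.sin (k + h n)) -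
      Real.arcsin (a n * Real.sin k))) atTop
      (𝓝 (d * (Real.cos k / √(1 - (A * Real.sin k) ^ 2)))) := by
  have hk : Tendsto (fun n => k + h n) atTop (𝓝 k) := by simpa using hh.const_add k
  have h1 := tendsto_mul_sub_of_hasStrictDerivAt (Real.hasStrictDerivAt_sin k)
    (s := fun n : ℕ => n * a n) tendsto_const_nhds hk (by simpa using hd)
  have h2 := tendsto_mul_sub_of_hasStrictDerivAt (hasStrictDerivAt_arcsin_mul_sin hA k)
    (s := fun n : ℕ => (n : ℝ)) (ha.mul_const _) (ha.mul ((Real.continuous_sin.tendsto k).comp hk))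
    (h1.congr fun n => by simp only [Function.comp]; ring)
  refine (tendsto_congr_lim h2 (by ring)).congr fun n => rfl

theorem tendsto_branch (σ : ℂ) {a k : ℕ → ℝ} {A K : ℝ} (hA : |A| < 1) (ha : Tendsto a atTop (𝓝 A))
    (hk : Tendsto k atTop (𝓝 K)) (φ : Fin 2 → ℂ) (j : Fin 2) :
    Tendsto (fun n => branch σ (a n) (k n) φ j) atTop (𝓝 (branch σ A K φ j)) :=
  Tendsto.comp (g := fun p : ℝ × ℝ => branch σ p.1 p.2 φ j) (f := fun n => (a n, k n))
    (continuousAt_branch σ hA K φ j).tendsto (ha.prodMk_nhds hk)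

theorem eventually_abs_lt_one {a : ℕ → ℝ} {A : ℝ} (hA : |A| < 1) (ha : Tendsto a atTop (𝓝 A)) :
    ∀ᶠ n in atTop, |a n| < 1 :=
  ha.abs.eventually (gt_mem_nhds hA)

theorem tendsto_sum_conj_branch (σ τ : ℂ) {a h : ℕ → ℝ} {A : ℝ} (hA : |A| < 1)
    (ha : Tendsto a atTop (𝓝 A)) (hh : Tendsto h atTop (𝓝 0)) (k : ℝ) (φ : Fin 2 → ℂ) :
    Tendsto (fun n => ∑ j, conj (branch σ (a n) k φ j) * branch τ (a n) (k + h n) φ j) atTop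
      (𝓝 (∑ j, conj (branch σ A k φ j) * branch τ A k φ j)) := by
  refine tendsto_finsetSum _ fun j _ => ?_
  have hk : Tendsto (fun n => k + h n) atTop (𝓝 k) := by simpa using hh.const_add k
  exact ((Complex.continuous_conj.tendsto _).comp
    (tendsto_branch σ hA ha tendsto_const_nhds φ j)).mul (tendsto_branch τ hA ha hk φ j)

/-- Products within one branch carry the phase difference `t' - t`, which converges. Mixed products
carry the phase sum, which need not converge, but their coefficients tend to zero by orthogonality.
-/
theorem tendsto_sum_conj_waveFn {a h : ℕ → ℝ} {A d : ℝ} (hA : |A| < 1)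
    (ha : Tendsto a atTop (𝓝 A)) (hh : Tendsto h atTop (𝓝 0))
    (hd : Tendsto (fun n : ℕ => n * a n * h n) atTop (𝓝 d)) {φ : Fin 2 → ℂ}
    (hφ : ∑ j, ‖φ j‖ ^ 2 = 1) (k : ℝ) :
    Tendsto (fun n => ∑ j, conj (waveFn (a n) φ n k j) * waveFn (a n) φ n (k + h n) j) atTop
      (𝓝 (Complex.exp (-((d * (Real.cos k / √(1 - (A * Real.sin k) ^ 2)) : ℝ) * Complex.I)) *
          ((1 + reflForm A k φ) / 2) +
        Complex.exp ((d * (Real.cos k / √(1 - (A * Real.sin k) ^ 2)) : ℝ) * Complex.I) *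
          ((1 - reflForm A k φ) / 2))) := by
  set t : ℕ → ℝ := fun n => n * Real.arcsin (a n * Real.sin k) with ht
  set t' : ℕ → ℝ := fun n => n * Real.arcsin (a n * Real.sin (k + h n)) with ht'
  set S : ℂ → ℂ → ℕ → ℂ := fun σ τ n =>
    ∑ j, conj (branch σ (a n) k φ j) * branch τ (a n) (k + h n) φ j with hS
  have hlim : ∀ σ τ : ℂ, conj σ = σ → Tendsto (S σ τ) atTop
      (𝓝 (((1 + σ * τ) * 1 + (σ + τ) * reflForm A k φ) / 4)) := by
    intro σ τ hσ
    have := tendsto_sum_conj_branch σ τ hA ha hh k φ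
    rwa [sum_conj_branch_mul hσ hA, sum_conj_mul_self hφ] at this
  have hdiff : Tendsto (fun n => t' n - t n) atTop
      (𝓝 (d * (Real.cos k / √(1 - (A * Real.sin k) ^ 2)))) :=
    (tendsto_mul_arcsin_sub hA ha hh hd k).congr fun n => by simp only [ht, ht']; ring
  have hsq : ∀ n : ℕ, ((-1 : ℂ) ^ n) * (-1) ^ n = 1 := fun n => by
    rw [← mul_pow]; norm_num
  have hexp : ∀ n, ∑ j, conj (waveFn (a n) φ n k j) * waveFn (a n) φ n (k + h n) j =
      (Complex.exp (-((t' n - t n : ℝ) * Complex.I)) * S 1 1 n +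
        Complex.exp ((t' n - t n : ℝ) * Complex.I) * S (-1) (-1) n) +
      ((-1) ^ n * Complex.exp ((t n + t' n : ℝ) * Complex.I) * S 1 (-1) n +
        (-1) ^ n * Complex.exp (-((t n + t' n : ℝ) * Complex.I)) * S (-1) 1 n) := by
    intro n
    have e1 : Complex.exp (-((t' n - t n : ℝ) * Complex.I)) =
        Complex.exp (t n * Complex.I) * Complex.exp (-(t' n * Complex.I)) := by
      rw [← Complex.exp_add]; congr 1; push_cast; ring
    have e2 : Complex.exp ((t' n - t n : ℝ) * Complex.I) =
        Complex.exp (-(t n * Complex.I)) * Complex.exp (t' n * Complex.I) := by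
      rw [← Complex.exp_add]; congr 1; push_cast; ring
    have e3 : Complex.exp ((t n + t' n : ℝ) * Complex.I) =
        Complex.exp (t n * Complex.I) * Complex.exp (t' n * Complex.I) := by
      rw [← Complex.exp_add]; congr 1; push_cast; ring
    have e4 : Complex.exp (-((t n + t' n : ℝ) * Complex.I)) =
        Complex.exp (-(t n * Complex.I)) * Complex.exp (-(t' n * Complex.I)) := by
      rw [← Complex.exp_add]; congr 1; push_cast; ring
    have c1 : conj (Complex.exp (t n * Complex.I)) = Complex.exp (-(t n * Complex.I)) := by
      rw [← Complex.exp_conj]; congr 1; simp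
    have c2 : conj (Complex.exp (-(t n * Complex.I))) = Complex.exp (t n * Complex.I) := by
      rw [← Complex.exp_conj]; congr 1; simp
    rw [e1, e2, e3, e4]
    simp only [hS, waveFn, Fin.sum_univ_two, map_add, map_mul, map_pow, map_neg, map_one]
    simp only [← show t n = n * Real.arcsin (a n * Real.sin k) from rfl,
      ← show t' n = n * Real.arcsin (a n * Real.sin (k + h n)) from rfl, c1, c2]
    linear_combination (Complex.exp (-(t n * Complex.I)) * Complex.exp (t' n * Complex.I) *
      (conj (branch (-1) (a n) k φ 0) * branch (-1) (a n) (k + h n) φ 0 +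
        conj (branch (-1) (a n) k φ 1) * branch (-1) (a n) (k + h n) φ 1)) * hsq n
  simp_rw [hexp]
  -- Only the modulus one of the oscillating phases matters.
  have hz : ∀ (c f : ℕ → ℂ), (∀ n, ‖c n‖ = 1) → Tendsto f atTop (𝓝 0) →
      Tendsto (fun n => c n * f n) atTop (𝓝 0) := by
    intro c f hc hf
    rw [tendsto_zero_iff_norm_tendsto_zero] at hf ⊢
    exact hf.congr fun n => by rw [norm_mul, hc, one_mul]
  have z1 := hz (fun n => (-1) ^ n * Complex.exp ((t n + t' n : ℝ) * Complex.I)) (S 1 (-1))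
    (fun n => by simp [-Complex.ofReal_add, Complex.norm_exp_ofReal_mul_I])
    (by simpa using hlim 1 (-1) (by simp))
  have z2 := hz (fun n => (-1) ^ n * Complex.exp (-((t n + t' n : ℝ) * Complex.I))) (S (-1) 1)
    (fun n => by rw [norm_mul, norm_exp_neg_ofReal_mul_I]; simp)
    (by simpa using hlim (-1) 1 (by simp))
  have hc : Tendsto (fun n => ((t' n - t n : ℝ) : ℂ) * Complex.I) atTop
      (𝓝 ((d * (Real.cos k / √(1 - (A * Real.sin k) ^ 2)) : ℝ) * Complex.I)) :=
    ((Complex.continuous_ofReal.tendsto _).comp hdiff).mul_const _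
  have p1 := (Complex.continuous_exp.tendsto _).comp hc.neg
  have p2 := (Complex.continuous_exp.tendsto _).comp hc
  have hfin := ((p1.mul (hlim 1 1 (by simp))).add (p2.mul (hlim (-1) (-1) (by simp)))).add
    (z1.add z2)
  exact tendsto_congr_lim hfin (by ring)

theorem tendsto_integral_conj_waveFn {a h : ℕ → ℝ} {A d : ℝ} (hA : |A| < 1)
    (ha : Tendsto a atTop (𝓝 A)) (hh : Tendsto h atTop (𝓝 0))
    (hd : Tendsto (fun n : ℕ => n * a n * h n) atTop (𝓝 d)) {φ : Fin 2 → ℂ}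
    (hφ : ∑ j, ‖φ j‖ ^ 2 = 1) :
    Tendsto (fun n => ∫ k in (-Real.pi)..Real.pi,
        ∑ j, conj (waveFn (a n) φ n k j) * waveFn (a n) φ n (k + h n) j) atTop
      (𝓝 (∫ k in (-Real.pi)..Real.pi,
        (Complex.exp (-((d * (Real.cos k / √(1 - (A * Real.sin k) ^ 2)) : ℝ) * Complex.I)) *
          ((1 + reflForm A k φ) / 2) +
        Complex.exp ((d * (Real.cos k / √(1 - (A * Real.sin k) ^ 2)) : ℝ) * Complex.I) *
          ((1 - reflForm A k φ) / 2)))) := by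
  have hlt := eventually_abs_lt_one hA ha
  -- The bound `8` is two coordinates times the product of two factors of norm at most `2`.
  refine intervalIntegral.tendsto_integral_filter_of_dominated_convergence (fun _ => 8) ?_ ?_
    intervalIntegrable_const ?_
  · filter_upwards [hlt] with n hn
    refine (Continuous.aestronglyMeasurable ?_)
    refine continuous_finsetSum _ fun j _ => ?_
    have := continuous_waveFn hn φ n j
    exact (Complex.continuous_conj.comp this).mul (this.comp (by fun_prop))
  · filter_upwards [hlt] with n hn
    refine ae_of_all _ fun k _ => ?_
    refine (norm_sum_le _ _).trans ?_
    rw [Fin.sum_univ_two]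
    simp only [norm_mul, RCLike.norm_conj]
    have b := fun k j => norm_waveFn_le hn n k hφ j
    have h0 := mul_le_mul (b k 0) (b (k + h n) 0) (norm_nonneg _) zero_le_two
    have h1 := mul_le_mul (b k 1) (b (k + h n) 1) (norm_nonneg _) zero_le_two
    linarith
  · exact ae_of_all _ fun k _ => tendsto_sum_conj_waveFn hA ha hh hd hφ k

/-! ### Characteristic functions -/

theorem ftdLaw_toReal (ρ : ℕ → unitInterval) (qL qR : ℂ) (hq : ‖qL‖ ^ 2 + ‖qR‖ ^ 2 = 1) (n : ℕ)
    (x : ℤ) : (ftdLaw ρ qL qR hq n x).toReal = prob (ftdCoin (ρ n)) (qL • eL + qR • eR) n x :=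
  ENNReal.toReal_ofReal (Finset.sum_nonneg fun _ _ => sq_nonneg _)

theorem charFun_scaledLaw (ρ : ℕ → unitInterval) (qL qR : ℂ) (hq : ‖qL‖ ^ 2 + ‖qR‖ ^ 2 = 1) (n : ℕ)
    (hρ : √(ρ n : ℝ) < 1) (c ξ : ℝ) :
    charFun (scaledLaw (ftdLaw ρ qL qR hq n) c : Measure ℝ) ξ =
      (2 * Real.pi : ℂ)⁻¹ * ∫ k in (-Real.pi)..Real.pi,
        ∑ j, conj (waveFn √(ρ n : ℝ) (qL • eL + qR • eR) n k j) *
          waveFn √(ρ n : ℝ) (qL • eL + qR • eR) n (k + ξ / c) j := by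
  have hpi : (2 * Real.pi : ℂ) ≠ 0 :=
    mul_ne_zero two_ne_zero (Complex.ofReal_ne_zero.2 Real.pi_ne_zero)
  rw [integral_conj_waveFn_mul (ρ n) hρ, ← mul_assoc, inv_mul_cancel₀ hpi, one_mul,
    charFun_apply_real]
  change ∫ x, _ ∂(Measure.map _ _) = _
  have hm : Measurable fun x : ℤ => (x : ℝ) / c := measurable_of_countable _
  rw [integral_map hm.aemeasurable (by fun_prop), PMF.integral_eq_tsum]
  · rw [tsum_eq_sum (s := Finset.Icc (-n : ℤ) n)]
    · refine Finset.sum_congr rfl fun x _ => ?_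
      rw [ftdLaw_toReal, Complex.real_smul, mul_comm]
      congr 2
      push_cast
      ring
    · intro x hx
      rw [ftdLaw_toReal, prob, amplitude_eq_zero_of_lt]
      · simp
      · rw [Finset.mem_Icc] at hx
        grind
  · refine Integrable.of_bound (measurable_of_countable _).aestronglyMeasurable 1
      (ae_of_all _ fun x => ?_)
    rw [← Complex.ofReal_mul, Complex.norm_exp_ofReal_mul_I]

/-! ### Characteristic functions of the two limit laws -/

theorem integral_withDensity_indicator {c : ℝ} {f g : ℝ → ℝ}
    (hg : ∀ x, g x = (Set.Ioo (-c) c).indicator f x) (hm : Measurable f)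
    (hpos : ∀ x ∈ Set.Ioo (-c) c, 0 ≤ f x) (F : ℝ → ℂ) :
    ∫ x, F x ∂(volume.withDensity fun x => ENNReal.ofReal (g x)) =
      ∫ x in Set.Ioo (-c) c, (f x : ℂ) * F x := by
  have hgm : Measurable g := by
    rw [funext hg]
    exact hm.indicator measurableSet_Ioo
  rw [integral_withDensity_eq_integral_toReal_smul hgm.ennreal_ofReal (by simp),
    ← integral_indicator measurableSet_Ioo]
  refine integral_congr_ae (ae_of_all _ fun x => ?_)
  simp only [hg]
  by_cases hx : x ∈ Set.Ioo (-c) c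
  · simp only [Set.indicator_of_mem hx, ENNReal.toReal_ofReal (hpos x hx), Complex.real_smul]
  · simp only [Set.indicator_of_notMem hx, ENNReal.ofReal_zero, ENNReal.toReal_zero, zero_smul]

/-- The group velocity of the walk, up to the factor `a`. -/
def velocity (a k : ℝ) : ℝ := Real.cos k / √(1 - (a * Real.sin k) ^ 2)

theorem hasDerivAt_velocity {a : ℝ} (ha : |a| < 1) (k : ℝ) :
    HasDerivAt (velocity a)
      (-(Real.sin k * (1 - a ^ 2) / √(1 - (a * Real.sin k) ^ 2) ^ 3)) k := by
  have hD := sqrt_one_sub_pos ha k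
  have hlt := sub_pos.2 (sq_mul_sin_lt_one ha k)
  have hD2 : √(1 - (a * Real.sin k) ^ 2) ^ 2 = 1 - (a * Real.sin k) ^ 2 := Real.sq_sqrt hlt.le
  have h1 : HasDerivAt (fun y => √(1 - (a * Real.sin y) ^ 2))
      (-(a ^ 2 * Real.sin k * Real.cos k) / √(1 - (a * Real.sin k) ^ 2)) k := by
    refine (((((Real.hasDerivAt_sin k).const_mul a).fun_pow 2).const_sub 1).sqrt
      hlt.ne').congr_deriv ?_
    field_simp
    ring
  refine ((Real.hasDerivAt_cos k).div h1 hD.ne').congr_deriv ?_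
  set D := √(1 - (a * Real.sin k) ^ 2)
  field_simp
  rw [hD2]
  linear_combination a ^ 2 * Real.sin k * Real.sin_sq_add_cos_sq k

theorem velocity_strictAntiOn {a : ℝ} (ha : |a| < 1) :
    StrictAntiOn (velocity a) (Set.Icc 0 Real.pi) := by
  refine strictAntiOn_of_deriv_neg (convex_Icc _ _)
    (fun k _ => (hasDerivAt_velocity ha k).continuousAt.continuousWithinAt) fun k hk => ?_
  rw [interior_Icc] at hk
  rw [(hasDerivAt_velocity ha k).deriv]
  have h1 := Real.sin_pos_of_pos_of_lt_pi hk.1 hk.2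
  have h2 := sqrt_one_sub_pos ha k
  have h3 : 0 < 1 - a ^ 2 := sub_pos.2 ((sq_lt_one_iff_abs_lt_one a).2 ha)
  have : 0 < Real.sin k * (1 - a ^ 2) / √(1 - (a * Real.sin k) ^ 2) ^ 3 := by positivity
  linarith

/-- Change of variables `x = r v(k)`, a decreasing bijection from `(0, π)` onto `(-r, r)`. The
parameters `a` and `r` are independent: `a = r` serves Konno's law and `a = 0` the arcsine-type law.
-/
theorem integral_Ioo_eq_integral_velocity {a r : ℝ} (ha : |a| < 1) (hr : 0 < r) (G : ℝ → ℂ) :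
    ∫ x in Set.Ioo (-r) r, G x = ∫ k in Set.Ioo 0 Real.pi,
      (r * (Real.sin k * (1 - a ^ 2) / √(1 - (a * Real.sin k) ^ 2) ^ 3)) •
        G (r * velocity a k) := by
  have hanti : StrictAntiOn (fun k => r * velocity a k) (Set.Icc 0 Real.pi) :=
    fun x hx y hy hxy => mul_lt_mul_of_pos_left (velocity_strictAntiOn ha hx hy hxy) hr
  have hder : ∀ k, HasDerivAt (fun k => r * velocity a k)
      (r * -(Real.sin k * (1 - a ^ 2) / √(1 - (a * Real.sin k) ^ 2) ^ 3)) k :=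
    fun k => (hasDerivAt_velocity ha k).const_mul r
  have h0 : r * velocity a 0 = r := by simp [velocity]
  have hπ : r * velocity a Real.pi = -r := by simp [velocity]
  have himg : (fun k => r * velocity a k) '' Set.Ioo 0 Real.pi = Set.Ioo (-r) r := by
    refine Set.Subset.antisymm ?_ ?_
    · rintro _ ⟨k, hk, rfl⟩
      have hk' := Set.Ioo_subset_Icc_self hk
      have e1 := hanti (Set.left_mem_Icc.2 Real.pi_pos.le) hk' hk.1
      have e2 := hanti hk' (Set.right_mem_Icc.2 Real.pi_pos.le) hk.2
      simp only [h0, hπ] at e1 e2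
      exact ⟨e2, e1⟩
    · have := intermediate_value_Ioo' Real.pi_pos.le (f := fun k => r * velocity a k)
        (fun k _ => (hder k).continuousAt.continuousWithinAt)
      simpa only [h0, hπ] using this
  rw [← himg, integral_image_eq_integral_abs_deriv_smul measurableSet_Ioo
    (fun k _ => (hder k).hasDerivWithinAt) (hanti.injOn.mono Set.Ioo_subset_Icc_self)]
  refine setIntegral_congr_fun measurableSet_Ioo fun k hk => ?_
  have h1 := Real.sin_pos_of_pos_of_lt_pi hk.1 hk.2
  have h2 := sqrt_one_sub_pos ha k
  have h3 : 0 < 1 - a ^ 2 := sub_pos.2 ((sq_lt_one_iff_abs_lt_one a).2 ha)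
  have : 0 < Real.sin k * (1 - a ^ 2) / √(1 - (a * Real.sin k) ^ 2) ^ 3 := by positivity
  simp only [mul_neg, abs_neg, abs_of_pos (mul_pos hr this)]

/-- Under `x = r v(k)`, with `D = √(1 - r² sin² k)`, one has `1 - x² = (1 - r²) / D²` and `r² - x² =
r² sin² k (1 - r²) / D²`; density times Jacobian is then the constant `1 / π`. -/
theorem charFun_konnoLaw {r : ℝ} (hr0 : 0 < r) (hr1 : r < 1) (ξ : ℝ) :
    charFun (konnoLaw r hr0 hr1 : Measure ℝ) ξ =
      (Real.pi : ℂ)⁻¹ * ∫ k in (0 : ℝ)..Real.pi,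
        Complex.exp ((r * ξ * velocity r k : ℝ) * Complex.I) := by
  have ha : |r| < 1 := by rwa [abs_of_pos hr0]
  have hb : 0 < 1 - r ^ 2 := sub_pos.2 ((sq_lt_one_iff_abs_lt_one r).2 ha)
  rw [charFun_apply_real]
  change ∫ x, _ ∂(volume.withDensity _) = _
  rw [integral_withDensity_indicator (c := r)
    (f := fun x => √(1 - r ^ 2) / (Real.pi * (1 - x ^ 2) * √(r ^ 2 - x ^ 2)))
    (fun x => by simp only [konnoDensity, abs_of_pos hr0]) (by fun_prop),
    integral_Ioo_eq_integral_velocity ha hr0, intervalIntegral.integral_of_le Real.pi_pos.le,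
    integral_Ioc_eq_integral_Ioo, ← integral_const_mul]
  · refine setIntegral_congr_fun measurableSet_Ioo fun k hk => ?_
    have hs := Real.sin_pos_of_pos_of_lt_pi hk.1 hk.2
    have hD := sqrt_one_sub_pos ha k
    have hD2 : √(1 - (r * Real.sin k) ^ 2) ^ 2 = 1 - (r * Real.sin k) ^ 2 :=
      Real.sq_sqrt (sub_pos.2 (sq_mul_sin_lt_one ha k)).le
    have hcs := Real.sin_sq_add_cos_sq k
    have hB : √(1 - r ^ 2) ^ 2 = 1 - r ^ 2 := Real.sq_sqrt hb.le
    have hB0 : 0 < √(1 - r ^ 2) := Real.sqrt_pos.2 hb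
    have e0 : velocity r k = Real.cos k / √(1 - (r * Real.sin k) ^ 2) := rfl
    generalize √(1 - (r * Real.sin k) ^ 2) = D at *
    generalize √(1 - r ^ 2) = B at *
    have e1 : 1 - (r * velocity r k) ^ 2 = (B / D) ^ 2 := by
      rw [e0]
      field_simp
      rw [hD2, hB]
      linear_combination (-r ^ 2) * hcs
    have e2 : √(r ^ 2 - (r * velocity r k) ^ 2) = r * Real.sin k * B / D := by
      rw [show r ^ 2 - (r * velocity r k) ^ 2 = (r * Real.sin k * B / D) ^ 2 by
        rw [e0]
        field_simp
        rw [hD2, hB]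
        linear_combination -hcs]
      exact Real.sqrt_sq (by positivity)
    simp only [e1, e2]
    rw [Complex.real_smul, ← mul_assoc, ← Complex.ofReal_mul]
    congr 1
    · rw [← Complex.ofReal_inv]
      congr 1
      rw [← hB]
      field_simp
    · congr 1
      push_cast
      ring
  · intro x hx
    have h1 : 0 < 1 - x ^ 2 := by nlinarith [hx.1, hx.2]
    have := Real.pi_pos
    positivity

theorem charFun_arcsineLaw {qL qR : ℂ} (hq : ‖qL‖ ^ 2 + ‖qR‖ ^ 2 = 1) {r : ℝ} (hr : 0 < r)
    (ξ : ℝ) :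
    charFun (arcsineLaw qL qR hq r hr : Measure ℝ) ξ =
      (Real.pi : ℂ)⁻¹ * ∫ k in (0 : ℝ)..Real.pi,
        Complex.exp ((r * ξ * velocity 0 k : ℝ) * Complex.I) *
          (1 - ((qL * conj qR + conj qL * qR).re * velocity 0 k : ℝ)) := by
  have ha : |(0 : ℝ)| < 1 := by simp
  set κ : ℝ := (qL * conj qR + conj qL * qR).re with hκ
  have hκ1 : |κ| ≤ 1 := abs_two_re_le hq
  rw [charFun_apply_real]
  change ∫ x, _ ∂(volume.withDensity _) = _
  rw [integral_withDensity_indicator (c := r)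
    (f := fun x => (1 - κ * x / r) * (1 / (Real.pi * √(r ^ 2 - x ^ 2))))
    (fun x => by
      simp only [arcsineDensity, abs_of_pos hr, Set.indicator_apply, ← hκ]
      split_ifs <;> simp) (by fun_prop),
    integral_Ioo_eq_integral_velocity ha hr, intervalIntegral.integral_of_le Real.pi_pos.le,
    integral_Ioc_eq_integral_Ioo, ← integral_const_mul]
  · refine setIntegral_congr_fun measurableSet_Ioo fun k hk => ?_
    have hs := Real.sin_pos_of_pos_of_lt_pi hk.1 hk.2
    have hv : velocity 0 k = Real.cos k := by simp [velocity]
    have e2 : √(r ^ 2 - (r * Real.cos k) ^ 2) = r * Real.sin k := by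
      rw [show r ^ 2 - (r * Real.cos k) ^ 2 = (r * Real.sin k) ^ 2 by
        linear_combination -r ^ 2 * Real.sin_sq_add_cos_sq k]
      exact Real.sqrt_sq (by positivity)
    simp only [hv, e2]
    rw [Complex.real_smul, ← mul_assoc, ← Complex.ofReal_mul]
    have e3 : r * (Real.sin k * (1 - 0 ^ 2) / √(1 - (0 * Real.sin k) ^ 2) ^ 3) *
        ((1 - κ * (r * Real.cos k) / r) * (1 / (Real.pi * (r * Real.sin k)))) =
        Real.pi⁻¹ * (1 - κ * Real.cos k) := by
      simp
      field_simp
    rw [e3, show (ξ : ℂ) * (r * Real.cos k : ℝ) * Complex.I =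
      (r * ξ * Real.cos k : ℝ) * Complex.I by
      push_cast; ring]
    push_cast
    ring
  · intro x hx
    have h4 : κ * x / r ≤ 1 := by
      rw [div_le_one hr]
      calc κ * x ≤ |κ * x| := le_abs_self _
        _ = |κ| * |x| := abs_mul _ _
        _ ≤ 1 * r := mul_le_mul hκ1 (abs_lt.2 hx).le (abs_nonneg _) zero_le_one
        _ = r := one_mul r
    have := Real.pi_pos
    have h5 : 0 ≤ 1 - κ * x / r := by linarith
    positivity

/-! ### Symmetrization of the limiting integral -/

theorem velocity_add_pi (a k : ℝ) : velocity a (k + Real.pi) = -velocity a k := by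
  simp [velocity, neg_div]

theorem velocity_neg (a k : ℝ) : velocity a (-k) = velocity a k := by
  simp [velocity]

/-- The shift by `π` negates `cos k` and `e^{±ik}` but fixes `sin² k`, hence negates `N`. -/
theorem reflForm_add_pi (a k : ℝ) (φ : Fin 2 → ℂ) :
    reflForm a (k + Real.pi) φ = -reflForm a k φ := by
  simp only [reflForm, Fin.sum_univ_two, refl, Matrix.cons_val_zero, Matrix.cons_val_one,
    exp_mul_I_real, exp_neg_mul_I_real, Real.cos_add_pi, Real.sin_add_pi, mul_neg, neg_sq]
  push_cast
  ring

/-- The coefficient of the velocity in the even part of `⟨φ, N φ⟩`. -/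
def drift (a : ℝ) (φ : Fin 2 → ℂ) : ℂ :=
  a * (conj (φ 0) * φ 0 - conj (φ 1) * φ 1) +
    (√(1 - a ^ 2) : ℝ) * (conj (φ 0) * φ 1 + conj (φ 1) * φ 0)

theorem reflForm_add_reflForm_neg (a k : ℝ) (φ : Fin 2 → ℂ) :
    reflForm a k φ + reflForm a (-k) φ = 2 * (drift a φ * (velocity a k : ℝ)) := by
  simp only [reflForm, Fin.sum_univ_two, refl, Matrix.cons_val_zero, Matrix.cons_val_one, drift,
    exp_mul_I_real, exp_neg_mul_I_real, Real.cos_neg, Real.sin_neg, mul_neg, neg_sq, velocity]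
  push_cast
  ring

theorem continuous_velocity {a : ℝ} (ha : |a| < 1) : Continuous (velocity a) :=
  continuous_iff_continuousAt.2 fun k => (hasDerivAt_velocity ha k).continuousAt

theorem continuous_reflForm {a : ℝ} (ha : |a| < 1) (φ : Fin 2 → ℂ) :
    Continuous fun k => reflForm a k φ := by
  refine continuous_finsetSum _ fun j _ => continuous_const.mul ?_
  rw [continuous_iff_continuousAt]
  intro k
  exact ContinuousAt.comp (g := fun p : ℝ × ℝ => refl p.1 p.2 φ j) (f := fun k : ℝ => (a, k))
    (continuousAt_refl ha k φ j) (by fun_prop)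

/-- The first summand is the second one shifted by `π`, so by periodicity it has the same integral.
Folding `[-π, 0]` onto `[0, π]` then leaves only the even part of `⟨φ, N φ⟩`, which is a multiple of
the velocity. -/
theorem integral_symmetrize {a : ℝ} (ha : |a| < 1) (d : ℝ) (φ : Fin 2 → ℂ) :
    ∫ k in (-Real.pi)..Real.pi,
        (Complex.exp (-((d * velocity a k : ℝ) * Complex.I)) * ((1 + reflForm a k φ) / 2) +
        Complex.exp ((d * velocity a k : ℝ) * Complex.I) * ((1 - reflForm a k φ) / 2)) =
      2 * ∫ k in (0 : ℝ)..Real.pi, Complex.exp ((d * velocity a k : ℝ) * Complex.I) *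
        (1 - drift a φ * (velocity a k : ℝ)) := by
  have hv := continuous_velocity ha
  have hw := continuous_reflForm ha φ
  set f : ℝ → ℂ := fun k =>
    Complex.exp ((d * velocity a k : ℝ) * Complex.I) * ((1 - reflForm a k φ) / 2) with hf
  have hfc : Continuous f := by fun_prop
  have hfi : ∀ u v, IntervalIntegrable f volume u v := fun u v => hfc.intervalIntegrable u v
  have hshift : ∀ k, Complex.exp (-((d * velocity a k : ℝ) * Complex.I)) *
      ((1 + reflForm a k φ) / 2) = f (k + Real.pi) := by
    intro k
    simp only [hf, velocity_add_pi, reflForm_add_pi, mul_neg, Complex.ofReal_neg, neg_mul,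
      sub_neg_eq_add]
  have hper : Function.Periodic f (2 * Real.pi) := by
    intro k
    simp only [hf]
    rw [show k + 2 * Real.pi = k + Real.pi + Real.pi by ring, velocity_add_pi, velocity_add_pi,
      reflForm_add_pi, reflForm_add_pi, neg_neg, neg_neg]
  have hint : ∫ k in (-Real.pi)..Real.pi, f (k + Real.pi) = ∫ k in (-Real.pi)..Real.pi, f k := by
    rw [intervalIntegral.integral_comp_add_right]
    have := hper.intervalIntegral_add_eq 0 (-Real.pi)
    rw [show -Real.pi + 2 * Real.pi = Real.pi by ring] at this
    rw [← this]
    congr 1 <;> ring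
  have hneg : ∫ k in (-Real.pi)..0, f k = ∫ k in (0 : ℝ)..Real.pi, f (-k) := by
    rw [intervalIntegral.integral_comp_neg, neg_zero]
  simp_rw [hshift]
  rw [intervalIntegral.integral_add ((by fun_prop : Continuous fun k =>
    f (k + Real.pi)).intervalIntegrable _ _) (hfi _ _), hint, ← two_mul,
    ← intervalIntegral.integral_add_adjacent_intervals (hfi (-Real.pi) 0) (hfi 0 Real.pi), hneg,
    ← intervalIntegral.integral_add ((by fun_prop : Continuous fun k =>
    f (-k)).intervalIntegrable _ _) (hfi _ _)]
  congr 1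
  refine intervalIntegral.integral_congr fun k _ => ?_
  simp only [hf, velocity_neg]
  linear_combination (-(Complex.exp ((d * velocity a k : ℝ) * Complex.I)) / 2) *
    reflForm_add_reflForm_neg a k φ

theorem sum_sq_initial {qL qR : ℂ} (hq : ‖qL‖ ^ 2 + ‖qR‖ ^ 2 = 1) :
    ∑ j, ‖(qL • eL + qR • eR) j‖ ^ 2 = 1 := by
  simpa [Fin.sum_univ_two, eL, eR] using hq

/-- The limit of the characteristic functions of the rescaled walk, when the coin parameters
converge to `A < 1` and the scaling is ballistic with respect to them. -/
theorem tendsto_charFun_scaledLaw {ρ : ℕ → unitInterval} {qL qR : ℂ}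
    (hq : ‖qL‖ ^ 2 + ‖qR‖ ^ 2 = 1) {A r : ℝ} (hA : |A| < 1)
    (ha : Tendsto (fun n => √(ρ n : ℝ)) atTop (𝓝 A)) {c : ℕ → ℝ} (hc : Tendsto c atTop atTop)
    (hr : ∀ᶠ n : ℕ in atTop, n * √(ρ n : ℝ) = r * c n) (ξ : ℝ) :
    Tendsto (fun n => charFun (scaledLaw (ftdLaw ρ qL qR hq n) (c n) : Measure ℝ) ξ) atTop
      (𝓝 ((Real.pi : ℂ)⁻¹ * ∫ k in (0 : ℝ)..Real.pi,
        Complex.exp ((r * ξ * velocity A k : ℝ) * Complex.I) *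
          (1 - drift A (qL • eL + qR • eR) * (velocity A k : ℝ)))) := by
  have hh : Tendsto (fun n => ξ / c n) atTop (𝓝 0) := hc.const_div_atTop ξ
  have hd : Tendsto (fun n : ℕ => n * √(ρ n : ℝ) * (ξ / c n)) atTop (𝓝 (r * ξ)) := by
    refine tendsto_const_nhds.congr' ?_
    filter_upwards [hr, hc.eventually_ne_atTop 0] with n hn hcn
    rw [hn]
    field_simp
  have h := (tendsto_integral_conj_waveFn hA ha hh hd (sum_sq_initial hq)).const_mul
    ((2 * Real.pi : ℂ)⁻¹)
  have hs := integral_symmetrize hA (r * ξ) (qL • eL + qR • eR)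
  unfold velocity at hs ⊢
  rw [hs] at h
  refine (tendsto_congr_lim h ?_).congr' ?_
  · rw [← mul_assoc, mul_inv, mul_comm (2 : ℂ)⁻¹, inv_mul_cancel_right₀ two_ne_zero]
  · filter_upwards [eventually_abs_lt_one hA ha] with n hn
    rw [charFun_scaledLaw ρ qL qR hq n (lt_of_abs_lt hn)]

/-! ### Bessel's integral -/

/-- Bessel's integral `(2π)⁻¹ ∫ e^{i (t sin k - x k)} dk` over `[-π, π]`. -/
def besselInt (x : ℤ) (t : ℝ) : ℂ :=
  (2 * Real.pi : ℂ)⁻¹ * ∫ k in (-Real.pi)..Real.pi,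
    Complex.exp (-(x * (k * Complex.I))) * Complex.exp ((t * Real.sin k : ℝ) * Complex.I)

theorem ofReal_two_pi_ne_zero : (2 * Real.pi : ℂ) ≠ 0 :=
  mul_ne_zero two_ne_zero (Complex.ofReal_ne_zero.2 Real.pi_ne_zero)

theorem two_pi_mul_besselInt (x : ℤ) (t : ℝ) :
    2 * Real.pi * besselInt x t = ∫ k in (-Real.pi)..Real.pi,
      Complex.exp (-(x * (k * Complex.I))) * Complex.exp ((t * Real.sin k : ℝ) * Complex.I) := by
  rw [besselInt, ← mul_assoc, mul_inv_cancel₀ ofReal_two_pi_ne_zero, one_mul]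

theorem besselInt_zero (x : ℤ) : besselInt x 0 = if x = 0 then 1 else 0 := by
  have h : ∀ k : ℝ, Complex.exp (-(x * (k * Complex.I))) *
      Complex.exp (((0 : ℝ) * Real.sin k : ℝ) * Complex.I) =
      Complex.exp ((-x : ℤ) * (k * Complex.I)) := by
    intro k; simp
  rw [besselInt]
  simp_rw [h, integral_exp_int, neg_eq_zero]
  split_ifs
  · exact inv_mul_cancel₀ ofReal_two_pi_ne_zero
  · simp

theorem exp_int_mul_add_pi (x : ℤ) (k : ℝ) :
    Complex.exp (-(x * ((k + Real.pi : ℝ) * Complex.I))) =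
      (-1) ^ x * Complex.exp (-(x * (k * Complex.I))) := by
  have : Complex.exp (-(x * (Real.pi * Complex.I))) = (-1) ^ x := by
    rw [Complex.exp_neg, Complex.exp_int_mul, Complex.exp_pi_mul_I, ← zpow_neg]
    rcases Int.even_or_odd x with h | h
    · rw [h.neg_one_zpow, (even_neg.2 h).neg_one_zpow]
    · rw [h.neg_one_zpow, (odd_neg.2 h).neg_one_zpow]
  rw [← this, ← Complex.exp_add]
  congr 1
  push_cast
  ring

/-- Shift `k` by `π`: this negates `sin k` and multiplies `e^{-ixk}` by `(-1)^x`. -/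
theorem besselInt_neg_right (x : ℤ) (t : ℝ) : besselInt x (-t) = (-1) ^ x * besselInt x t := by
  set f : ℝ → ℂ := fun k =>
    Complex.exp (-(x * (k * Complex.I))) * Complex.exp ((t * Real.sin k : ℝ) * Complex.I) with hf
  have hsq : ((-1 : ℂ) ^ x) * (-1) ^ x = 1 := by
    rw [← mul_zpow]; norm_num
  have hshift : ∀ k : ℝ, Complex.exp (-(x * (k * Complex.I))) *
      Complex.exp ((-t * Real.sin k : ℝ) * Complex.I) = (-1) ^ x * f (k + Real.pi) := by
    intro k
    simp only [hf, exp_int_mul_add_pi, Real.sin_add_pi]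
    rw [show t * -Real.sin k = -t * Real.sin k by ring]
    linear_combination (-(Complex.exp (-(x * (k * Complex.I))) *
      Complex.exp ((-t * Real.sin k : ℝ) * Complex.I))) * hsq
  have hper : Function.Periodic f (2 * Real.pi) := by
    intro k
    simp only [hf]
    rw [show k + 2 * Real.pi = k + Real.pi + Real.pi by ring, exp_int_mul_add_pi,
      exp_int_mul_add_pi, Real.sin_add_pi, Real.sin_add_pi, neg_neg, ← mul_assoc, hsq, one_mul]
  have hint : ∫ k in (-Real.pi)..Real.pi, f (k + Real.pi) = ∫ k in (-Real.pi)..Real.pi, f k := by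
    rw [intervalIntegral.integral_comp_add_right]
    have := hper.intervalIntegral_add_eq 0 (-Real.pi)
    rw [show -Real.pi + 2 * Real.pi = Real.pi by ring] at this
    rw [← this]
    congr 1 <;> ring
  rw [besselInt]
  simp_rw [hshift]
  rw [intervalIntegral.integral_const_mul, hint, besselInt]
  ring

theorem besselInt_neg_left (x : ℤ) (t : ℝ) : besselInt (-x) t = (-1) ^ x * besselInt x t := by
  rw [← besselInt_neg_right, besselInt, besselInt]
  congr 1
  have := intervalIntegral.integral_comp_neg (a := -Real.pi) (b := Real.pi) (fun k : ℝ =>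
    Complex.exp (-(x * (k * Complex.I))) * Complex.exp ((-t * Real.sin k : ℝ) * Complex.I))
  rw [neg_neg] at this
  rw [← this]
  refine intervalIntegral.integral_congr fun k _ => ?_
  simp

/-- The derivative of the integrand integrates to zero over a period, and the factor `cos k =
(e^{ik} + e^{-ik}) / 2` it contains shifts the order by one each way. -/
theorem besselInt_recurrence (x : ℤ) (t : ℝ) :
    2 * x * besselInt x t = t * (besselInt (x - 1) t + besselInt (x + 1) t) := by
  set f : ℤ → ℝ → ℂ := fun x k =>
    Complex.exp (-(x * (k * Complex.I))) * Complex.exp ((t * Real.sin k : ℝ) * Complex.I) with hf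
  have hfc : ∀ x, Continuous (f x) := fun x => by fun_prop
  have hfi : ∀ x, IntervalIntegrable (f x) volume (-Real.pi) Real.pi :=
    fun x => (hfc x).intervalIntegrable _ _
  have hder : ∀ k, HasDerivAt (f x)
      (-(x * Complex.I) * f x k + t * Complex.I / 2 * (f (x - 1) k + f (x + 1) k)) k := by
    intro k
    have h1 : HasDerivAt (fun k : ℝ => -((x : ℂ) * ((k : ℂ) * Complex.I))) (-(x * Complex.I)) k :=
      ((((Complex.ofRealCLM.hasDerivAt (x := k)).mul_const Complex.I).const_mul
        (x : ℂ)).fun_neg).congr_deriv (by simp)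
    have h2 : HasDerivAt (fun k : ℝ => ((t * Real.sin k : ℝ) : ℂ) * Complex.I)
        ((t * Real.cos k : ℝ) * Complex.I) k :=
      ((Real.hasDerivAt_sin k).const_mul t).ofReal_comp.mul_const Complex.I
    refine (h1.cexp.mul h2.cexp).congr_deriv ?_
    have e1 : Complex.exp (-((x - 1 : ℤ) * (k * Complex.I))) =
        Complex.exp (k * Complex.I) * Complex.exp (-(x * (k * Complex.I))) := by
      rw [← Complex.exp_add]; congr 1; push_cast; ring
    have e2 : Complex.exp (-((x + 1 : ℤ) * (k * Complex.I))) =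
        Complex.exp (-(k * Complex.I)) * Complex.exp (-(x * (k * Complex.I))) := by
      rw [← Complex.exp_add]; congr 1; push_cast; ring
    simp only [hf]
    rw [e1, e2, exp_mul_I_real k, exp_neg_mul_I_real]
    push_cast
    ring
  have hint := intervalIntegral.integral_eq_sub_of_hasDerivAt (a := -Real.pi) (b := Real.pi)
    (fun k _ => hder k) (Continuous.intervalIntegrable (by fun_prop) _ _)
  have hend : f x Real.pi - f x (-Real.pi) = 0 := by
    have := exp_int_mul_add_pi x (-Real.pi)
    have h' := exp_int_mul_add_pi x 0
    have hsq : ((-1 : ℂ) ^ x) * (-1) ^ x = 1 := by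
      rw [← mul_zpow]; norm_num
    simp only [neg_add_cancel, zero_add, Complex.ofReal_zero, zero_mul, mul_zero, neg_zero,
      Complex.exp_zero, mul_one] at this h'
    simp only [hf, Real.sin_neg, Real.sin_pi, h', neg_zero]
    linear_combination Complex.exp ((t * 0 : ℝ) * Complex.I) * ((-1) ^ x * this +
      Complex.exp (-(x * ((-Real.pi : ℝ) * Complex.I))) * hsq)
  have hs : ∀ x, ∫ k in (-Real.pi)..Real.pi, f x k = 2 * Real.pi * besselInt x t :=
    fun x => (two_pi_mul_besselInt x t).symm
  rw [hend, intervalIntegral.integral_add (((hfc x).const_mul _).intervalIntegrable _ _)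
    (Continuous.intervalIntegrable (by fun_prop) _ _), intervalIntegral.integral_const_mul,
    intervalIntegral.integral_const_mul, intervalIntegral.integral_add (hfi _) (hfi _), hs, hs,
    hs] at hint
  have hne := mul_ne_zero ofReal_two_pi_ne_zero Complex.I_ne_zero
  refine mul_left_cancel₀ hne ?_
  linear_combination (-2 : ℂ) * hint

/-! ### Power series of Bessel's integral -/

theorem hasSum_mul_of_summable_norm {f g : ℕ → ℂ} {s t : ℂ} (hf : HasSum f s) (hg : HasSum g t)
    (hf' : Summable fun n => ‖f n‖) (hg' : Summable fun n => ‖g n‖) :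
    HasSum (fun p : ℕ × ℕ => f p.1 * g p.2) (s * t) :=
  hf.mul hg (summable_mul_of_summable_norm hf' hg')

theorem hasSum_pow_div_factorial (z : ℂ) :
    HasSum (fun n : ℕ => z ^ n / n.factorial) (Complex.exp z) := by
  rw [Complex.exp_eq_exp_ℂ]
  exact NormedSpace.expSeries_div_hasSum_exp z

theorem summable_norm_pow_div_factorial (z : ℂ) :
    Summable fun n : ℕ => ‖z ^ n / n.factorial‖ := by
  simpa using Real.summable_pow_div_factorial ‖z‖

theorem hasSum_pow_div_factorial_mul (z w : ℂ) :
    HasSum (fun p : ℕ × ℕ => (z ^ p.1 / p.1.factorial) * (w ^ p.2 / p.2.factorial))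
      (Complex.exp z * Complex.exp w) :=
  hasSum_mul_of_summable_norm (f := fun n => z ^ n / n.factorial)
    (g := fun n => w ^ n / n.factorial) (hasSum_pow_div_factorial z) (hasSum_pow_div_factorial w)
    (summable_norm_pow_div_factorial z) (summable_norm_pow_div_factorial w)

/-- Expand `e^{it sin k}` as the product of the exponentials of `-(t/2) e^{-ik}` and `(t/2) e^{ik}`
and integrate termwise; the double series is dominated by its absolutely summable coefficients. -/
theorem hasSum_besselInt (x : ℤ) (t : ℝ) :
    HasSum (fun p : ℕ × ℕ => (-(t / 2 : ℂ)) ^ p.1 / p.1.factorial * ((t / 2 : ℂ) ^ p.2 /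
      p.2.factorial) * if (p.2 : ℤ) - p.1 - x = 0 then (2 * Real.pi : ℂ) else 0)
      (2 * Real.pi * besselInt x t) := by
  set c : ℕ × ℕ → ℂ := fun p =>
    (-(t / 2 : ℂ)) ^ p.1 / p.1.factorial * ((t / 2 : ℂ) ^ p.2 / p.2.factorial) with hc
  have hcs : Summable fun p => ‖c p‖ := (hasSum_pow_div_factorial_mul _ _).summable.norm
  rw [two_pi_mul_besselInt]
  have hterm : ∀ p : ℕ × ℕ, ∫ k in (-Real.pi)..Real.pi,
      Complex.exp (((p.2 : ℤ) - p.1 - x : ℤ) * (k * Complex.I)) * c p =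
      c p * if (p.2 : ℤ) - p.1 - x = 0 then (2 * Real.pi : ℂ) else 0 := by
    intro p
    rw [intervalIntegral.integral_mul_const, integral_exp_int, mul_comm]
  have hnorm : ∀ (m : ℤ) (k : ℝ), ‖Complex.exp (m * (k * Complex.I))‖ = 1 := by
    intro m k
    rw [← mul_assoc, ← Complex.ofReal_intCast, ← Complex.ofReal_mul,
      Complex.norm_exp_ofReal_mul_I]
  refine (funext hterm : _ = _) ▸ intervalIntegral.hasSum_integral_of_dominated_convergence
    (fun p _ => ‖c p‖) (fun p => (Continuous.aestronglyMeasurable (by fun_prop)))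
    (fun p => ae_of_all _ fun k _ => ?_) (ae_of_all _ fun k _ => hcs) intervalIntegrable_const
    (ae_of_all _ fun k _ => ?_)
  · rw [norm_mul, hnorm, one_mul]
  · have h := (hasSum_pow_div_factorial_mul (-(t / 2 : ℂ) * Complex.exp (-(k * Complex.I)))
      ((t / 2 : ℂ) * Complex.exp (k * Complex.I))).mul_left (Complex.exp (-(x * (k * Complex.I))))
    have e : Complex.exp (-(t / 2 : ℂ) * Complex.exp (-(k * Complex.I))) *
        Complex.exp ((t / 2 : ℂ) * Complex.exp (k * Complex.I)) =
        Complex.exp ((t * Real.sin k : ℝ) * Complex.I) := by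
      rw [← Complex.exp_add, exp_mul_I_real, exp_neg_mul_I_real]
      congr 1
      push_cast
      ring
    rw [e] at h
    refine Eq.subst (motive := fun f => HasSum f _) (funext fun p => ?_) h
    have e2 : Complex.exp (((p.2 : ℤ) - p.1 - x : ℤ) * (k * Complex.I)) =
        Complex.exp (-(x * (k * Complex.I))) * (Complex.exp (-(k * Complex.I)) ^ p.1 *
          Complex.exp (k * Complex.I) ^ p.2) := by
      rw [← Complex.exp_nat_mul, ← Complex.exp_nat_mul, ← Complex.exp_add, ← Complex.exp_add]
      congr 1
      push_cast
      ring
    rw [e2, mul_pow, mul_pow]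
    simp only [hc]
    ring

/-- The terms of the power series of the Bessel function. -/
def besselTerm (x : ℤ) (t : ℝ) (k : ℕ) : ℝ :=
  (-1) ^ k / ((k.factorial : ℝ) * Real.Gamma ((x : ℝ) + k + 1)) * (t / 2) ^ (x + 2 * (k : ℤ))

theorem besselTerm_of_eq {x : ℤ} {k m : ℕ} (h : x + k = m) (t : ℝ) :
    besselTerm x t k = (-(t / 2)) ^ k / k.factorial * ((t / 2) ^ m / m.factorial) := by
  have e1 : (x : ℝ) + k + 1 = (m : ℝ) + 1 := by
    have : ((x + k : ℤ) : ℝ) = (m : ℤ) := by rw [h]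
    push_cast at this
    rw [this]
  have e2 : x + 2 * (k : ℤ) = ((m + k : ℕ) : ℤ) := by push_cast; lia
  rw [besselTerm, e1, Real.Gamma_nat_eq_factorial, e2, zpow_natCast, neg_pow (t / 2), pow_add]
  field_simp

theorem besselTerm_of_neg {x : ℤ} {k : ℕ} (h : x + k < 0) (t : ℝ) : besselTerm x t k = 0 := by
  obtain ⟨m, hm⟩ : ∃ m : ℕ, x + k + 1 = -(m : ℤ) := ⟨(-(x + k + 1)).toNat, by lia⟩
  have e1 : (x : ℝ) + k + 1 = -(m : ℝ) := by exact_mod_cast hm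
  rw [besselTerm, e1, Real.Gamma_neg_nat_eq_zero]
  simp

/-- For a fixed power `q` of the first exponential, orthogonality leaves only the power `x + q` of
the second. If `x + q < 0` there is none, in agreement with the value `0` of the term at a pole of
`Γ`. -/
theorem hasSum_besselTerm (x : ℤ) (t : ℝ) :
    HasSum (fun k => ((besselTerm x t k : ℝ) : ℂ)) (besselInt x t) := by
  have h := (hasSum_besselInt x t).prod_fiberwise (g := fun k =>
    ((besselTerm x t k : ℝ) : ℂ) * (2 * Real.pi)) fun q => ?_
  · have h2 := h.mul_right (2 * Real.pi : ℂ)⁻¹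
    simp only [mul_inv_cancel_right₀ ofReal_two_pi_ne_zero] at h2
    rwa [mul_comm (2 * Real.pi : ℂ), mul_inv_cancel_right₀ ofReal_two_pi_ne_zero] at h2
  · simp only
    by_cases hx : x + q < 0
    · rw [besselTerm_of_neg hx]
      have : ∀ p : ℕ, ¬ ((p : ℤ) - q - x = 0) := fun p => by lia
      simp only [this, if_false, mul_zero, Complex.ofReal_zero, zero_mul]
      exact hasSum_zero
    · obtain ⟨m, hm⟩ : ∃ m : ℕ, x + q = m := ⟨(x + q).toNat, by lia⟩
      rw [besselTerm_of_eq hm]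
      have hm' : (m : ℤ) - q - x = 0 := by lia
      convert hasSum_single (f := fun p : ℕ => (-(t / 2 : ℂ)) ^ q / q.factorial *
        ((t / 2 : ℂ) ^ p / p.factorial) *
          if (p : ℤ) - q - x = 0 then (2 * Real.pi : ℂ) else 0) m (fun p hp => ?_) using 1
      · simp [hm']
      · have : ¬ ((p : ℤ) - q - x = 0) := fun h0 => hp (by lia)
        simp [this]

theorem besselInt_eq_besselJ (x : ℤ) (t : ℝ) : besselInt x t = (besselJ x t : ℝ) := by
  rw [← (hasSum_besselTerm x t).tsum_eq, ← Complex.ofReal_tsum]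
  rfl

theorem hasSum_besselTerm_real (x : ℤ) (t : ℝ) : HasSum (besselTerm x t) (besselJ x t) := by
  have := hasSum_besselTerm x t
  rw [besselInt_eq_besselJ] at this
  exact_mod_cast this

theorem besselJ_neg_left (x : ℤ) (t : ℝ) : besselJ (-x) t = (-1) ^ x * besselJ x t := by
  have := besselInt_neg_left x t
  rw [besselInt_eq_besselJ, besselInt_eq_besselJ] at this
  apply Complex.ofReal_injective
  push_cast
  exact this

theorem besselJ_recurrence (x : ℤ) (t : ℝ) :
    2 * x * besselJ x t = t * (besselJ (x - 1) t + besselJ (x + 1) t) := by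
  have := besselInt_recurrence x t
  simp only [besselInt_eq_besselJ] at this
  exact_mod_cast this

/-! ### Positivity and Turán's inequality on `(0, 1)` -/

/-- For `t / 2 ≤ 1` the power series alternates with decreasing terms, so its sum lies between its
first two partial sums. -/
theorem besselJ_nat_bounds {t : ℝ} (h0 : 0 < t) (h1 : t < 1) (m : ℕ) :
    (t / 2) ^ m / m.factorial * (1 - (t / 2) ^ 2 / (m + 1)) ≤ besselJ m t ∧
      besselJ m t ≤ (t / 2) ^ m / m.factorial := by
  have hz0 : 0 < t / 2 := by linarith
  have hz1 : t / 2 ≤ 1 := by linarith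
  set u : ℕ → ℝ := fun k => (t / 2) ^ k / k.factorial *
    ((t / 2) ^ (m + k) / (m + k).factorial) with hu
  have hterm : ∀ k, besselTerm m t k = (-1) ^ k * u k := fun k => by
    rw [besselTerm_of_eq (m := m + k) (by push_cast; ring), neg_pow (t / 2)]
    simp only [hu]
    ring
  have hs := (hasSum_besselTerm_real m t).tendsto_sum_nat
  simp only [hterm] at hs
  have hanti : Antitone u := antitone_nat_of_succ_le fun k => by
    simp only [hu]
    have a1 : ∀ j : ℕ, (t / 2) ^ (j + 1) / (j + 1).factorial ≤ (t / 2) ^ j / j.factorial := by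
      intro j
      refine div_le_div₀ (by positivity) (pow_le_pow_of_le_one hz0.le hz1 j.le_succ)
        (by positivity) ?_
      exact_mod_cast Nat.factorial_le j.le_succ
    exact mul_le_mul (a1 k) (a1 (m + k)) (by positivity) (by positivity)
  have hl := hanti.alternating_series_le_tendsto hs 1
  have hr := hanti.tendsto_le_alternating_series hs 0
  have e0 : u 0 = (t / 2) ^ m / m.factorial := by simp [hu]
  have e1 : u 1 = (t / 2) ^ m / m.factorial * ((t / 2) ^ 2 / (m + 1)) := by
    simp only [hu, Nat.factorial_succ]
    push_cast
    simp
    field_simp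
    ring
  simp [Finset.sum_range_succ] at hl hr
  rw [e0] at hl hr
  rw [e1] at hl
  constructor
  · linarith
  · exact hr

theorem besselJ_nat_pos {t : ℝ} (h0 : 0 < t) (h1 : t < 1) (m : ℕ) : 0 < besselJ m t := by
  refine lt_of_lt_of_le ?_ (besselJ_nat_bounds h0 h1 m).1
  have hz : 0 < t / 2 := by linarith
  refine mul_pos (by positivity) (sub_pos.2 ?_)
  rw [div_lt_one (by positivity)]
  have : (0 : ℝ) ≤ m := m.cast_nonneg
  nlinarith

theorem besselJ_ne_zero {t : ℝ} (h0 : 0 < t) (h1 : t < 1) (x : ℤ) : besselJ x t ≠ 0 := by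
  obtain ⟨m, rfl | rfl⟩ := x.eq_nat_or_neg
  · exact (besselJ_nat_pos h0 h1 m).ne'
  · rw [besselJ_neg_left]
    exact mul_ne_zero (zpow_ne_zero _ (by norm_num)) (besselJ_nat_pos h0 h1 m).ne'

/-- At order `0` the left side is `-J_1²`. At order `m + 1`, with leading term `u`, the product of
the neighbours is at most `u² (m + 1) / (m + 2)`, whereas the square is at least `u² (1 - s)²` with
`s < 1 / (4 (m + 2))`. -/
theorem besselJ_turan_nat {t : ℝ} (h0 : 0 < t) (h1 : t < 1) (m : ℕ) :
    besselJ ((m : ℤ) - 1) t * besselJ ((m : ℤ) + 1) t < besselJ m t ^ 2 := by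
  rcases m with _ | m
  · have e1 : besselJ (((0 : ℕ) : ℤ) - 1) t = -besselJ 1 t := by
      have := besselJ_neg_left 1 t
      simpa using this
    have e2 : ((0 : ℕ) : ℤ) + 1 = 1 := by norm_num
    rw [e1, e2]
    have := besselJ_nat_pos h0 h1 0
    nlinarith [sq_nonneg (besselJ 1 t), sq_pos_of_pos this]
  · have e1 : (((m + 1 : ℕ) : ℤ) - 1) = (m : ℤ) := by push_cast; ring
    have e2 : (((m + 1 : ℕ) : ℤ) + 1) = ((m + 2 : ℕ) : ℤ) := by push_cast; ring
    rw [e1, e2]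
    have hz : 0 < t / 2 := by linarith
    have b0 := (besselJ_nat_bounds h0 h1 m).2
    have b1 := (besselJ_nat_bounds h0 h1 (m + 1)).1
    have b2 := (besselJ_nat_bounds h0 h1 (m + 2)).2
    have p2 := besselJ_nat_pos h0 h1 (m + 2)
    set u := (t / 2) ^ (m + 1) / (m + 1).factorial with hu
    have hu0 : 0 < u := by positivity
    have hm : (0 : ℝ) ≤ m := m.cast_nonneg
    have hprod : (t / 2) ^ m / m.factorial * ((t / 2) ^ (m + 2) / (m + 2).factorial) =
        u ^ 2 * ((m + 1) / (m + 2)) := by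
      simp only [hu, Nat.factorial_succ]
      push_cast
      field_simp
      ring
    have hs : (t / 2) ^ 2 / (((m + 1 : ℕ) : ℝ) + 1) < 1 / (4 * (m + 2)) := by
      push_cast
      rw [div_lt_div_iff₀ (by positivity) (by positivity)]
      have ht2 : t ^ 2 < 1 := by nlinarith
      nlinarith
    set s := (t / 2) ^ 2 / (((m + 1 : ℕ) : ℝ) + 1) with hsd
    have hs0 : 0 < s := by positivity
    have hq : 1 / (4 * ((m : ℝ) + 2)) ≤ 1 / 8 := by
      apply one_div_le_one_div_of_le <;> linarith
    -- With `ε = 1 / (4 (m + 2))` the ratio is `1 - 4ε`, which is below `1 - 2s ≤ (1 - s)²` since `s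
    -- < ε`.
    have hfrac : ((m : ℝ) + 1) / (m + 2) = 1 - 4 * (1 / (4 * (m + 2))) := by
      field_simp
      ring
    calc besselJ m t * besselJ ((m + 2 : ℕ) : ℤ) t
        ≤ (t / 2) ^ m / m.factorial * ((t / 2) ^ (m + 2) / (m + 2).factorial) :=
          mul_le_mul b0 b2 p2.le (by positivity)
      _ = u ^ 2 * ((m + 1) / (m + 2)) := hprod
      _ < u ^ 2 * (1 - s) ^ 2 := by
          refine mul_lt_mul_of_pos_left ?_ (by positivity)
          rw [hfrac]
          nlinarith
      _ = (u * (1 - s)) ^ 2 := by ring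
      _ ≤ besselJ ((m + 1 : ℕ) : ℤ) t ^ 2 := by
          refine pow_le_pow_left₀ (mul_nonneg hu0.le (by linarith)) b1 2

/-- Turán's inequality for Bessel functions of integer order on `(0, 1)`. -/
theorem besselJ_turan {t : ℝ} (h0 : 0 < t) (h1 : t < 1) (x : ℤ) :
    besselJ (x - 1) t * besselJ (x + 1) t < besselJ x t ^ 2 := by
  obtain ⟨m, rfl | rfl⟩ := x.eq_nat_or_neg
  · exact besselJ_turan_nat h0 h1 m
  · have h := besselJ_turan_nat h0 h1 m
    rw [show -(m : ℤ) - 1 = -((m : ℤ) + 1) by ring, show -(m : ℤ) + 1 = -((m : ℤ) - 1) by ring,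
      besselJ_neg_left, besselJ_neg_left, besselJ_neg_left]
    have hsq : ((-1 : ℝ) ^ (m : ℤ)) * (-1) ^ (m : ℤ) = 1 := by
      rw [← mul_zpow]; norm_num
    rw [zpow_add₀ (by norm_num), zpow_sub₀ (by norm_num)]
    rw [zpow_one]
    nlinarith

/-- Expand the squares; the recurrence turns the cross factor `J_{x-1} + J_{x+1}` into `(2x / t)
J_x`. -/
theorem besselProfile_eq {qL qR : ℂ} (hq : ‖qL‖ ^ 2 + ‖qR‖ ^ 2 = 1) (x : ℤ) {t : ℝ} (ht : t ≠ 0) :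
    besselProfile qL qR x t = ‖qL * besselInt x t - qR * besselInt (x + 1) t‖ ^ 2 +
      ‖qR * besselInt x t - qL * besselInt (x - 1) t‖ ^ 2 := by
  have h := besselJ_recurrence x t
  have hr : 2 * x / t * besselJ x t = besselJ (x - 1) t + besselJ (x + 1) t := by
    field_simp
    linear_combination h
  simp only [besselProfile, besselInt_eq_besselJ, ← Complex.normSq_eq_norm_sq,
    Complex.normSq_apply] at hq ⊢
  simp
  linear_combination (-(2 * (qL.re * qR.re + qL.im * qR.im)) * besselJ x t) * hr -
    besselJ x t ^ 2 * hq

theorem besselProfile_pos {qL qR : ℂ} (hq : ‖qL‖ ^ 2 + ‖qR‖ ^ 2 = 1) (x : ℤ) {t : ℝ} (h0 : 0 < t)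
    (h1 : t < 1) : 0 < besselProfile qL qR x t := by
  rw [besselProfile_eq hq x h0.ne']
  simp only [besselInt_eq_besselJ]
  by_contra hle
  have hL : qL * besselJ x t - qR * besselJ (x + 1) t = 0 := by
    rw [← norm_eq_zero, ← sq_eq_zero_iff]
    nlinarith [sq_nonneg ‖qL * besselJ x t - qR * besselJ (x + 1) t‖,
      sq_nonneg ‖qR * besselJ x t - qL * besselJ (x - 1) t‖]
  have hR : qR * besselJ x t - qL * besselJ (x - 1) t = 0 := by
    rw [← norm_eq_zero, ← sq_eq_zero_iff]
    nlinarith [sq_nonneg ‖qL * besselJ x t - qR * besselJ (x + 1) t‖,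
      sq_nonneg ‖qR * besselJ x t - qL * besselJ (x - 1) t‖]
  have hT : ((besselJ x t ^ 2 - besselJ (x - 1) t * besselJ (x + 1) t : ℝ) : ℂ) ≠ 0 :=
    Complex.ofReal_ne_zero.2 (sub_pos.2 (besselJ_turan h0 h1 x)).ne'
  have hJ : ((besselJ x t : ℝ) : ℂ) ≠ 0 := Complex.ofReal_ne_zero.2 (besselJ_ne_zero h0 h1 x)
  -- Cramer's rule for the linear system `hL`, `hR`.
  have hqL : qL = 0 := by
    refine (mul_eq_zero.1 ?_).resolve_right hT
    push_cast
    linear_combination besselJ x t * hL + besselJ (x + 1) t * hR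
  have hqR : qR = 0 := by
    refine (mul_eq_zero.1 ?_).resolve_right hJ
    rw [hqL] at hR
    simpa using hR
  simp [hqL, hqR] at hq

/-! ### Localized limits -/

theorem branch_zero_left (σ : ℂ) (k : ℝ) (φ : Fin 2 → ℂ) :
    branch σ 0 k φ 0 = (φ 0 + σ * (Complex.exp (-(k * Complex.I)) * φ 1)) / 2 := by
  simp [branch, refl]

theorem branch_zero_right (σ : ℂ) (k : ℝ) (φ : Fin 2 → ℂ) :
    branch σ 0 k φ 1 = (φ 1 + σ * (Complex.exp (k * Complex.I) * φ 0)) / 2 := by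
  simp [branch, refl]

/-- The localized wave with Bessel amplitudes. -/
def besselVec (φ : Fin 2 → ℂ) (x : ℤ) (t : ℝ) : Fin 2 → ℂ :=
  ![φ 0 * besselInt x t - φ 1 * besselInt (x + 1) t,
    φ 1 * besselInt x t - φ 0 * besselInt (x - 1) t]

theorem integral_besselWave (x : ℤ) (t : ℝ) (c d : ℂ) (m : ℤ) :
    ∫ k in (-Real.pi)..Real.pi, Complex.exp (-(x * (k * Complex.I))) *
        (Complex.exp ((t * Real.sin k : ℝ) * Complex.I) *
          ((c + d * Complex.exp (-(m * (k * Complex.I)))) / 2)) =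
      Real.pi * (c * besselInt x t + d * besselInt (x + m) t) := by
  have h : ∀ k : ℝ, Complex.exp (-(x * (k * Complex.I))) *
      (Complex.exp ((t * Real.sin k : ℝ) * Complex.I) *
        ((c + d * Complex.exp (-(m * (k * Complex.I)))) / 2)) =
      c / 2 * (Complex.exp (-(x * (k * Complex.I))) *
        Complex.exp ((t * Real.sin k : ℝ) * Complex.I)) +
      d / 2 * (Complex.exp (-((x + m : ℤ) * (k * Complex.I))) *
        Complex.exp ((t * Real.sin k : ℝ) * Complex.I)) := by
    intro k
    have : Complex.exp (-((x + m : ℤ) * (k * Complex.I))) =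
        Complex.exp (-(x * (k * Complex.I))) * Complex.exp (-(m * (k * Complex.I))) := by
      rw [← Complex.exp_add]; congr 1; push_cast; ring
    rw [this]
    ring
  simp_rw [h]
  rw [intervalIntegral.integral_add (Continuous.intervalIntegrable (by fun_prop) _ _)
    (Continuous.intervalIntegrable (by fun_prop) _ _), intervalIntegral.integral_const_mul,
    intervalIntegral.integral_const_mul, ← two_pi_mul_besselInt, ← two_pi_mul_besselInt]
  ring

theorem integral_branch_neg_one (φ : Fin 2 → ℂ) (x : ℤ) (t : ℝ) (j : Fin 2) :
    ∫ k in (-Real.pi)..Real.pi, Complex.exp (-(x * (k * Complex.I))) *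
        (Complex.exp ((t * Real.sin k : ℝ) * Complex.I) * branch (-1) 0 k φ j) =
      Real.pi * besselVec φ x t j := by
  fin_cases j
  · have h := integral_besselWave x t (φ 0) (-φ 1) 1
    simp only [Fin.zero_eta, branch_zero_left, besselVec, Matrix.cons_val_zero]
    rw [show φ 0 * besselInt x t - φ 1 * besselInt (x + 1) t =
      φ 0 * besselInt x t + -φ 1 * besselInt (x + 1) t by ring, ← h]
    refine intervalIntegral.integral_congr fun k _ => ?_
    simp only [Int.cast_one, one_mul]
    ring
  · have h := integral_besselWave x t (φ 1) (-φ 0) (-1)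
    simp only [Fin.mk_one, branch_zero_right, besselVec, Matrix.cons_val_one, Matrix.cons_val_zero]
    rw [show φ 1 * besselInt x t - φ 0 * besselInt (x - 1) t =
      φ 1 * besselInt x t + -φ 0 * besselInt (x + -1) t by rw [← sub_eq_add_neg]; ring, ← h]
    refine intervalIntegral.integral_congr fun k _ => ?_
    simp only [Int.cast_neg, Int.cast_one, neg_mul, one_mul, neg_neg]
    ring

/-- The opposite sign in the branch is absorbed by the parity in `t` of the neighbouring orders, so
the vector of `integral_branch_neg_one` reappears with the sign `(-1)^x`. -/
theorem integral_branch_one (φ : Fin 2 → ℂ) (x : ℤ) (t : ℝ) (j : Fin 2) :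
    ∫ k in (-Real.pi)..Real.pi, Complex.exp (-(x * (k * Complex.I))) *
        (Complex.exp ((-t * Real.sin k : ℝ) * Complex.I) * branch 1 0 k φ j) =
      Real.pi * ((-1) ^ x * besselVec φ x t j) := by
  have hne : (-1 : ℂ) ≠ 0 := by norm_num
  fin_cases j
  · have h := integral_besselWave x (-t) (φ 0) (φ 1) 1
    simp only [Fin.zero_eta, branch_zero_left, besselVec, Matrix.cons_val_zero]
    rw [besselInt_neg_right, besselInt_neg_right, zpow_add₀ hne, zpow_one] at h
    rw [show (-1) ^ x * (φ 0 * besselInt x t - φ 1 * besselInt (x + 1) t) =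
      φ 0 * ((-1) ^ x * besselInt x t) + φ 1 * ((-1) ^ x * -1 * besselInt (x + 1) t) by ring, ← h]
    refine intervalIntegral.integral_congr fun k _ => ?_
    simp only [Int.cast_one, one_mul]
    ring
  · have h := integral_besselWave x (-t) (φ 1) (φ 0) (-1)
    simp only [Fin.mk_one, branch_zero_right, besselVec, Matrix.cons_val_one, Matrix.cons_val_zero]
    rw [besselInt_neg_right, besselInt_neg_right, ← sub_eq_add_neg, zpow_sub₀ hne, zpow_one] at h
    rw [show (-1) ^ x * (φ 1 * besselInt x t - φ 0 * besselInt (x - 1) t) =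
      φ 1 * ((-1) ^ x * besselInt x t) + φ 0 * ((-1) ^ x / -1 * besselInt (x - 1) t) by ring, ← h]
    refine intervalIntegral.integral_congr fun k _ => ?_
    simp only [Int.cast_neg, Int.cast_one, neg_mul, one_mul, neg_neg]
    ring

theorem norm_exp_int_mul_I (x : ℤ) (k : ℝ) : ‖Complex.exp (-(x * (k * Complex.I)))‖ = 1 := by
  rw [← mul_assoc, ← Complex.ofReal_intCast, ← Complex.ofReal_mul, norm_exp_neg_ofReal_mul_I]

/-- Since `arcsin` has derivative `1` at `0`, the phase `n * arcsin (a n * sin k)` tends to `t * sin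
k`. The sign `s` distinguishes the two branches. -/
theorem tendsto_integral_branch {s : ℝ} {σ : ℂ} {φ : Fin 2 → ℂ} {a : ℕ → ℝ} {t : ℝ} {j : Fin 2}
    (hb : ∀ {a : ℝ}, |a| < 1 → ∀ k, ‖branch σ a k φ j‖ ≤ 1)
    (ha : Tendsto a atTop (𝓝 0)) (ht : Tendsto (fun n : ℕ => n * a n) atTop (𝓝 t)) (x : ℤ) :
    Tendsto (fun n : ℕ => ∫ k in (-Real.pi)..Real.pi, Complex.exp (-(x * (k * Complex.I))) *
        (Complex.exp ((s * (n * Real.arcsin (a n * Real.sin k)) : ℝ) * Complex.I) *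
          branch σ (a n) k φ j)) atTop
      (𝓝 (∫ k in (-Real.pi)..Real.pi, Complex.exp (-(x * (k * Complex.I))) *
        (Complex.exp ((s * t * Real.sin k : ℝ) * Complex.I) * branch σ 0 k φ j))) := by
  have h01 : |(0 : ℝ)| < 1 := by simp
  have hlt := eventually_abs_lt_one h01 ha
  refine intervalIntegral.tendsto_integral_filter_of_dominated_convergence (fun _ => 1) ?_ ?_
    intervalIntegrable_const (ae_of_all _ fun k _ => ?_)
  · filter_upwards [hlt] with n hn
    have h1 := continuous_branch σ hn φ j
    have h2 : Continuous fun k => Real.arcsin (a n * Real.sin k) :=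
      Real.continuous_arcsin.comp (by fun_prop)
    exact Continuous.aestronglyMeasurable (by fun_prop)
  · filter_upwards [hlt] with n hn
    refine ae_of_all _ fun k _ => ?_
    rw [norm_mul, norm_mul, norm_exp_int_mul_I, Complex.norm_exp_ofReal_mul_I, one_mul, one_mul]
    exact hb hn k
  · refine Tendsto.const_mul _ (Tendsto.mul ?_ (tendsto_branch σ h01 ha tendsto_const_nhds φ j))
    have h1 : Tendsto (fun n : ℕ => a n * Real.sin k) atTop (𝓝 0) := by
      simpa using ha.mul_const (Real.sin k)
    have h0 : HasStrictDerivAt Real.arcsin 1 0 := by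
      simpa using Real.hasStrictDerivAt_arcsin (x := 0) (by norm_num) (by norm_num)
    have h2 := tendsto_mul_sub_of_hasStrictDerivAt h0 (s := fun n : ℕ => (n : ℝ))
      tendsto_const_nhds h1 (d := t * Real.sin k)
      ((ht.mul_const (Real.sin k)).congr fun n => by ring)
    have h3 : Tendsto (fun n : ℕ => s * (n * Real.arcsin (a n * Real.sin k))) atTop
        (𝓝 (s * t * Real.sin k)) := by
      have := h2.const_mul s
      simp only [Real.arcsin_zero, sub_zero, mul_one] at this
      rwa [mul_assoc]
    exact (Complex.continuous_exp.tendsto _).comp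
      (((Complex.continuous_ofReal.tendsto _).comp h3).mul_const _)

/-- Stated as a difference tending to zero because the sign `(-1)^n` generally prevents the
amplitude itself from converging. -/
theorem tendsto_amplitude_sub {ρ : ℕ → unitInterval} {φ : Fin 2 → ℂ} (hφ : ∑ j, ‖φ j‖ ^ 2 = 1)
    {t : ℝ} (ha : Tendsto (fun n => √(ρ n : ℝ)) atTop (𝓝 0))
    (ht : Tendsto (fun n : ℕ => n * √(ρ n : ℝ)) atTop (𝓝 t)) (x : ℤ) (j : Fin 2) :
    Tendsto (fun n : ℕ => amplitude (ftdCoin (ρ n)) φ n x j -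
      ((-1) ^ x + (-1) ^ n) / 2 * besselVec φ x t j) atTop (𝓝 0) := by
  have h1 := tendsto_integral_branch (s := -1) (fun ha k => norm_branch_one_le ha k hφ j) ha ht x
  have h2 := tendsto_integral_branch (s := 1)
    (fun ha k => norm_branch_neg_one_le ha k hφ j) ha ht x
  simp only [one_mul, neg_one_mul] at h1 h2
  rw [integral_branch_one] at h1
  rw [integral_branch_neg_one] at h2
  set I₁ : ℕ → ℂ := fun n => ∫ k in (-Real.pi)..Real.pi, Complex.exp (-(x * (k * Complex.I))) *
    (Complex.exp ((-(n * Real.arcsin (√(ρ n : ℝ) * Real.sin k)) : ℝ) * Complex.I) *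
      branch 1 √(ρ n : ℝ) k φ j) with hI₁
  set I₂ : ℕ → ℂ := fun n => ∫ k in (-Real.pi)..Real.pi, Complex.exp (-(x * (k * Complex.I))) *
    (Complex.exp ((n * Real.arcsin (√(ρ n : ℝ) * Real.sin k) : ℝ) * Complex.I) *
      branch (-1) √(ρ n : ℝ) k φ j) with hI₂
  have hsum : ∀ᶠ n in atTop, 2 * Real.pi * amplitude (ftdCoin (ρ n)) φ n x j =
      I₁ n + (-1) ^ n * I₂ n := by
    filter_upwards [eventually_abs_lt_one (by simp) ha] with n hn
    have c1 := continuous_branch 1 hn φ j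
    have c2 := continuous_branch (-1) hn φ j
    have c3 : Continuous fun k => Real.arcsin (√(ρ n : ℝ) * Real.sin k) :=
      Real.continuous_arcsin.comp (by fun_prop)
    rw [← integral_waveFn (ρ n) (lt_of_abs_lt hn), hI₁, hI₂]
    simp only
    rw [← intervalIntegral.integral_const_mul, ← intervalIntegral.integral_add
      (Continuous.intervalIntegrable (by fun_prop) _ _)
      (Continuous.intervalIntegrable (by fun_prop) _ _)]
    refine intervalIntegral.integral_congr fun k _ => ?_
    simp only [waveFn, Complex.ofReal_neg, neg_mul]
    ring
  have z1 := (tendsto_sub_nhds_zero_iff.2 h1).const_mul (2 * Real.pi : ℂ)⁻¹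
  have z2 := (tendsto_sub_nhds_zero_iff.2 h2).const_mul (2 * Real.pi : ℂ)⁻¹
  have z3 : Tendsto (fun n : ℕ => (-1 : ℂ) ^ n * ((2 * Real.pi : ℂ)⁻¹ *
      (I₂ n - Real.pi * besselVec φ x t j))) atTop (𝓝 0) := by
    rw [mul_zero, tendsto_zero_iff_norm_tendsto_zero] at z2
    rw [tendsto_zero_iff_norm_tendsto_zero]
    exact z2.congr fun n => by simp
  have z4 := z1.add z3
  rw [mul_zero, add_zero] at z4
  refine z4.congr' ?_
  filter_upwards [hsum] with n hn
  have hpi : (Real.pi : ℂ) ≠ 0 := Complex.ofReal_ne_zero.2 Real.pi_ne_zero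
  have e : amplitude (ftdCoin (ρ n)) φ n x j =
      (2 * Real.pi : ℂ)⁻¹ * (I₁ n + (-1) ^ n * I₂ n) := by
    rw [← hn, ← mul_assoc, inv_mul_cancel₀ ofReal_two_pi_ne_zero, one_mul]
  rw [e]
  field_simp
  ring

theorem norm_parity_sq (n : ℕ) (x : ℤ) :
    ‖((-1 : ℂ) ^ x + (-1) ^ n) / 2‖ ^ 2 = (1 + (-1 : ℝ) ^ ((n : ℤ) + x)) / 2 := by
  rw [zpow_add₀ (by norm_num), zpow_natCast]
  rcases Int.even_or_odd x with hx | hx <;> rcases Nat.even_or_odd n with hn | hn <;>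
    rw [hx.neg_one_zpow, hn.neg_one_pow, hx.neg_one_zpow, hn.neg_one_pow] <;> norm_num

theorem tendsto_norm_sq_sub {u v : ℕ → ℂ} {C : ℝ} (h : Tendsto (fun n => u n - v n) atTop (𝓝 0))
    (hv : ∀ n, ‖v n‖ ≤ C) : Tendsto (fun n => ‖u n‖ ^ 2 - ‖v n‖ ^ 2) atTop (𝓝 0) := by
  have hn := tendsto_zero_iff_norm_tendsto_zero.1 h
  have hb : Tendsto (fun n => ‖u n - v n‖ * (‖u n - v n‖ + 2 * C)) atTop (𝓝 0) := by
    simpa using hn.mul (hn.add_const (2 * C))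
  refine squeeze_zero_norm (fun n => ?_) hb
  have h1 := abs_norm_sub_norm_le (u n) (v n)
  have h2 : ‖u n‖ ≤ ‖u n - v n‖ + ‖v n‖ := by
    simpa using norm_add_le (u n - v n) (v n)
  rw [sq_sub_sq, Real.norm_eq_abs, abs_mul, mul_comm,
    abs_of_nonneg (add_nonneg (norm_nonneg (u n)) (norm_nonneg (v n)))]
  exact mul_le_mul h1 (by linarith [hv n]) (by positivity) (norm_nonneg _)

theorem norm_parity_le (n : ℕ) (x : ℤ) : ‖((-1 : ℂ) ^ x + (-1) ^ n) / 2‖ ≤ 1 := by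
  rw [norm_div, Complex.norm_ofNat, div_le_one two_pos]
  refine (norm_add_le _ _).trans ?_
  rw [norm_zpow, norm_pow, norm_neg, norm_one, one_zpow, one_pow]
  norm_num

theorem tendsto_prob_sub {ρ : ℕ → unitInterval} {φ : Fin 2 → ℂ} (hφ : ∑ j, ‖φ j‖ ^ 2 = 1)
    {t : ℝ} (ha : Tendsto (fun n => √(ρ n : ℝ)) atTop (𝓝 0))
    (ht : Tendsto (fun n : ℕ => n * √(ρ n : ℝ)) atTop (𝓝 t)) (x : ℤ) :
    Tendsto (fun n : ℕ => prob (ftdCoin (ρ n)) φ n x -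
      (1 + (-1 : ℝ) ^ ((n : ℤ) + x)) / 2 * ∑ j, ‖besselVec φ x t j‖ ^ 2) atTop (𝓝 0) := by
  have h := fun j => tendsto_norm_sq_sub (tendsto_amplitude_sub hφ ha ht x j)
    (C := ‖besselVec φ x t j‖) fun n => by
      rw [norm_mul]
      exact mul_le_of_le_one_left (norm_nonneg _) (norm_parity_le n x)
  have hs := tendsto_finsetSum Finset.univ fun j _ => h j
  rw [Finset.sum_const_zero] at hs
  refine hs.congr fun n => ?_
  rw [Finset.sum_sub_distrib, prob, Finset.mul_sum]
  congr 1
  refine Finset.sum_congr rfl fun j _ => ?_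
  rw [norm_mul, mul_pow, norm_parity_sq]

theorem sum_sq_besselVec {qL qR : ℂ} (hq : ‖qL‖ ^ 2 + ‖qR‖ ^ 2 = 1) (x : ℤ) {t : ℝ} (ht : t ≠ 0) :
    ∑ j, ‖besselVec (qL • eL + qR • eR) x t j‖ ^ 2 = besselProfile qL qR x t := by
  rw [besselProfile_eq hq x ht]
  simp [besselVec, Fin.sum_univ_two, eL, eR]

theorem sum_sq_besselVec_zero {qL qR : ℂ} (hq : ‖qL‖ ^ 2 + ‖qR‖ ^ 2 = 1) (x : ℤ) :
    ∑ j, ‖besselVec (qL • eL + qR • eR) x 0 j‖ ^ 2 =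
      if x = 0 then 1 else if x = 1 then ‖qL‖ ^ 2 else if x = -1 then ‖qR‖ ^ 2 else 0 := by
  simp only [besselVec, Fin.sum_univ_two, besselInt_zero, Matrix.cons_val_zero,
    Matrix.cons_val_one, sub_eq_zero, add_eq_zero_iff_eq_neg]
  by_cases h0 : x = 0
  · simp [h0, eL, eR, hq]
  by_cases h1 : x = 1
  · simp [h1, eL, eR]
  by_cases h2 : x = -1
  · simp [h2, eL, eR]
  simp [h0, h1, h2]

theorem prob_eq_zero_of_odd (H : Matrix (Fin 2) (Fin 2) ℂ) (φ : Fin 2 → ℂ) {n : ℕ} {x : ℤ}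
    (hx : Odd ((n : ℤ) + x)) : prob H φ n x = 0 := by
  simp [prob, amplitude_eq_zero_of_odd H φ n x hx]

end QW

end

/-! ### The four regimes -/

theorem tendsto_sqrt_zero_of_eq_div_rpow {r α : ℝ} {ρ : ℕ → unitInterval}
    (hρ : ∀ n : ℕ, 1 ≤ n → √(ρ n : ℝ) = r / (n : ℝ) ^ α) (hα : 0 < α) :
    Tendsto (fun n => √(ρ n : ℝ)) atTop (𝓝 0) := by
  have h := ((tendsto_rpow_atTop hα).comp tendsto_natCast_atTop_atTop).const_div_atTop r
  refine h.congr' ?_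
  filter_upwards [eventually_ge_atTop 1] with n hn
  rw [hρ n hn]
  rfl

theorem natCast_mul_sqrt_eq {r α : ℝ} {ρ : ℕ → unitInterval}
    (hρ : ∀ n : ℕ, 1 ≤ n → √(ρ n : ℝ) = r / (n : ℝ) ^ α) {n : ℕ} (hn : 1 ≤ n) :
    n * √(ρ n : ℝ) = r * (n : ℝ) ^ (1 - α) := by
  have h0 : (0 : ℝ) < n := by exact_mod_cast hn
  rw [hρ n hn, Real.rpow_sub h0, Real.rpow_one]
  ring

theorem mainTheorem7 (r : ℝ) (hr0 : 0 < r) (hr1 : r < 1) (α : ℝ)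
    (qL qR : ℂ) (hq : ‖qL‖ ^ 2 + ‖qR‖ ^ 2 = 1)
    (ρ : ℕ → unitInterval) (hρ : ∀ n : ℕ, 1 ≤ n → √(ρ n : ℝ) = r / (n : ℝ) ^ α) :
    (α = 0 → QW.IsSymmetricState ((r : ℝ) : ℂ) ((√(1 - r ^ 2) : ℝ) : ℂ) qL qR →
      Tendsto (fun n : ℕ => QW.scaledLaw (QW.ftdLaw ρ qL qR hq n) ((n : ℝ) ^ (1 - α))) atTop
        (𝓝 (QW.konnoLaw r hr0 hr1))) ∧
    (0 < α → α < 1 →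
      Tendsto (fun n : ℕ => QW.scaledLaw (QW.ftdLaw ρ qL qR hq n) ((n : ℝ) ^ (1 - α))) atTop
        (𝓝 (QW.arcsineLaw qL qR hq r hr0))) ∧
    (α = 1 → ∀ x : ℤ,
      (fun n : ℕ => (QW.ftdLaw ρ qL qR hq n x).toReal) ~[atTop]
        fun n : ℕ => (1 + (-1 : ℝ) ^ ((n : ℤ) + x)) / 2 * QW.besselProfile qL qR x r) ∧
    (1 < α → ∀ x : ℤ,
      Tendsto (fun m : ℕ => (QW.ftdLaw ρ qL qR hq (2 * m) x).toReal) atTop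
        (𝓝 (if x = 0 then 1 else 0)) ∧
      Tendsto (fun m : ℕ => (QW.ftdLaw ρ qL qR hq (2 * m + 1) x).toReal) atTop
        (𝓝 (if x = 1 then ‖qL‖ ^ 2 else if x = -1 then ‖qR‖ ^ 2 else 0))) := by
  have hφ := QW.sum_sq_initial hq
  have hscale : ∀ᶠ n : ℕ in atTop, n * √(ρ n : ℝ) = r * (n : ℝ) ^ (1 - α) :=
    (eventually_ge_atTop 1).mono fun n hn => natCast_mul_sqrt_eq hρ hn
  have hc : α < 1 → Tendsto (fun n : ℕ => (n : ℝ) ^ (1 - α)) atTop atTop := fun h =>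
    (tendsto_rpow_atTop (sub_pos.2 h)).comp tendsto_natCast_atTop_atTop
  refine ⟨?_, ?_, ?_, ?_⟩
  · rintro hα ⟨hR, hL, hs⟩
    have hr : |r| < 1 := by rwa [abs_of_pos hr0]
    have ha : Tendsto (fun n => √(ρ n : ℝ)) atTop (𝓝 r) := by
      refine tendsto_const_nhds.congr' ?_
      filter_upwards [eventually_ge_atTop 1] with n hn
      rw [hρ n hn, hα, Real.rpow_zero, div_one]
    refine ProbabilityMeasure.tendsto_iff_tendsto_charFun.2 fun ξ => ?_
    have h := QW.tendsto_charFun_scaledLaw hq hr ha (hc (by linarith)) hscale ξ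
    have hb : ((√(1 - r ^ 2) : ℝ) : ℂ) ≠ 0 := Complex.ofReal_ne_zero.2
      (Real.sqrt_pos.2 (sub_pos.2 ((sq_lt_one_iff_abs_lt_one r).2 hr))).ne'
    -- The coin entries are real and nonzero, so they cancel from the symmetry condition; together
    -- with `|q_L| = |q_R|` this makes the drift vanish.
    have hcross : conj qL * qR + conj qR * qL = 0 := by
      have hab := mul_ne_zero (Complex.ofReal_ne_zero.2 hr0.ne') hb
      refine (mul_eq_zero.1 ?_).resolve_left hab
      simp only [map_mul, Complex.conj_ofReal] at hs
      linear_combination hs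
    have hdrift : QW.drift r (qL • QW.eL + qR • QW.eR) = 0 := by
      simp only [QW.drift, Complex.conj_mul']
      simp [QW.eL, QW.eR, hR, hL, hcross]
    rw [QW.charFun_konnoLaw]
    simpa [hdrift] using h
  · intro h0 h1
    refine ProbabilityMeasure.tendsto_iff_tendsto_charFun.2 fun ξ => ?_
    have h := QW.tendsto_charFun_scaledLaw hq (by simp)
      (tendsto_sqrt_zero_of_eq_div_rpow hρ h0) (hc h1) hscale ξ
    have hdrift : QW.drift 0 (qL • QW.eL + qR • QW.eR) =
        ((qL * conj qR + conj qL * qR).re : ℝ) := by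
      -- The cross term is real, so the complex drift is the real coefficient in the arcsine
      -- density.
      have : conj (qL * conj qR + conj qL * qR) = qL * conj qR + conj qL * qR := by
        simp; ring
      rw [Complex.conj_eq_iff_re.1 this]
      simp [QW.drift, QW.eL, QW.eR]
      ring
    rw [QW.charFun_arcsineLaw]
    simpa only [hdrift, Complex.ofReal_mul] using h
  · intro hα x
    have ht : Tendsto (fun n : ℕ => n * √(ρ n : ℝ)) atTop (𝓝 r) := by
      refine tendsto_const_nhds.congr' ?_
      filter_upwards [hscale] with n hn
      rw [hn, hα, sub_self, Real.rpow_zero, mul_one]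
    have h := QW.tendsto_prob_sub hφ (tendsto_sqrt_zero_of_eq_div_rpow hρ (by linarith)) ht x
    have hpos := QW.besselProfile_pos hq x hr0 hr1
    simp_rw [QW.sum_sq_besselVec hq x hr0.ne'] at h
    refine isLittleO_iff.2 fun ε hε => ?_
    -- Positivity of the profile makes this an admissible threshold. For `n + x` even the comparison
    -- function is the profile itself; for `n + x` odd both sides vanish exactly.
    have hev := (Metric.tendsto_nhds.1 h) (ε * QW.besselProfile qL qR x r) (by positivity)
    filter_upwards [hev] with n hn
    rw [Pi.sub_apply, QW.ftdLaw_toReal]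
    rcases Int.even_or_odd ((n : ℤ) + x) with he | ho
    · rw [dist_zero_right] at hn
      refine hn.le.trans ?_
      rw [he.neg_one_zpow, Real.norm_of_nonneg (by positivity)]
      norm_num
    · rw [QW.prob_eq_zero_of_odd _ _ ho, ho.neg_one_zpow]
      norm_num
  · intro hα x
    have ht : Tendsto (fun n : ℕ => n * √(ρ n : ℝ)) atTop (𝓝 0) := by
      have h := ((tendsto_rpow_neg_atTop (sub_pos.2 hα)).comp
        tendsto_natCast_atTop_atTop).const_mul r
      rw [mul_zero] at h
      refine h.congr' ?_
      filter_upwards [hscale] with n hn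
      rw [hn, Function.comp, neg_sub]
    have h := QW.tendsto_prob_sub hφ (tendsto_sqrt_zero_of_eq_div_rpow hρ (by linarith)) ht x
    simp_rw [QW.sum_sq_besselVec_zero hq, ← QW.ftdLaw_toReal ρ qL qR hq] at h
    have h2 : Tendsto (fun m : ℕ => 2 * m) atTop atTop :=
      tendsto_id.const_mul_atTop' two_pos
    have h3 : Tendsto (fun m : ℕ => 2 * m + 1) atTop atTop := (tendsto_add_atTop_nat 1).comp h2
    -- Along times of fixed parity the parity factor is constant, so closeness to the oscillating
    -- approximation becomes convergence.
    have hlim : ∀ {f : ℕ → ℕ} {c : ℝ}, Tendsto f atTop atTop →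
        (∀ m, (1 + (-1 : ℝ) ^ ((f m : ℤ) + x)) / 2 *
          (if x = 0 then 1 else if x = 1 then ‖qL‖ ^ 2 else if x = -1 then ‖qR‖ ^ 2 else 0) = c) →
        Tendsto (fun m => (QW.ftdLaw ρ qL qR hq (f m) x).toReal) atTop (𝓝 c) := by
      intro f c hf hfc
      have h' := (h.comp hf).add_const c
      rw [zero_add] at h'
      refine h'.congr fun m => ?_
      simp only [Function.comp, hfc, sub_add_cancel]
    constructor
    · refine hlim h2 fun m => ?_
      have ev : Even ((2 * m : ℕ) : ℤ) := by simp
      rw [zpow_add₀ (by norm_num), ev.neg_one_zpow]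
      split_ifs with h0 h1 h1
      · simp [h0]
      · simp [h1]
      · simp [h1]
      · simp
    · refine hlim h3 fun m => ?_
      have od : Odd ((2 * m + 1 : ℕ) : ℤ) := by simp
      rw [zpow_add₀ (by norm_num), od.neg_one_zpow]
      split_ifs with h0 h1 h1 h1 h1
      · omega
      · omega
      · simp [h0]
      · simp [h1]
      · simp [h1]
      · simp
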